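/- For $s\ge 1$ put $a(s)=-1+\frac{1}{s^2(s+1)}$ and $b(s)=-s-\frac{1}{s^2(s+1)}$, and consider the real polynomial map $$F_s:\mathbb R\to\mathbb R,\qquad F_s(x)=a(s)x^3+b(s)x^2+1 .$$ For a map $f:\mathbb R\to\mathbb R$ such that each iterate $f^n$, $n\ge 1$, has finitely many fixed points, let $N_n(f)$ be the number of isolated fixed points of $f^n$, and let the Artin--Mazur zeta function of $f$ be the formal power series $\zeta_f(t)=\exp\left(\sum_{n\ge1}\frac{1}{n}N_n(f)t^n\right)$. A real polynomial all of whose critical points are real is called post-critically finite (PCF) if the union of the forward orbits of its critical points is finite, and hyperbolic if each of its critical points either is asymptotic to an attracting periodic cycle (a cycle whose multiplier has absolute value $<1$) or escapes to infinity. There exists $s_*>1$ such that for every $s\in[1,s_*]$ the polynomial $F_s$ has degree $3$, its two critical points are real and distinct, every iterate $F_s^n$ with $n\ge1$ has finitely many fixed points in $\mathbb R$, and $$\zeta_{F_s}(t)=\frac{1}{(1-t^3)(1-t^2)(1-t-t^2)} .$$ Moreover, there are uncountably many $s\in[1,s_*]$ for which $F_s$ is neither PCF nor hyperbolic. -/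

import Mathlib

open Filter Topology Polynomial

/-! ### The Artin-Mazur zeta function -/

/-- `N_n(f)`: the number of isolated fixed points of the `n`-th iterate of `f`. -/
noncomputable def numIsolatedFixedPts {X : Type*} [TopologicalSpace X] (f : X → X) (n : ℕ) : ℕ :=
  {x : X | f^[n] x = x ∧ ∀ᶠ y in 𝓝[≠] x, f^[n] y ≠ y}.ncard

/-- The formal power series `∑_{n ≥ 1} (N_n(f) / n) t^n`. -/
noncomputable def zetaExponent {X : Type*} [TopologicalSpace X] (f : X → X) : PowerSeries ℚ :=
  PowerSeries.mk fun n => if n = 0 then 0 else (numIsolatedFixedPts f n : ℚ) / (n : ℚ)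

/-- The exponent has zero constant term, so it may be substituted in the exponential series. -/
theorem zetaExponent_hasSubst {X : Type*} [TopologicalSpace X] (f : X → X) :
    PowerSeries.HasSubst (zetaExponent f) :=
  PowerSeries.HasSubst.of_constantCoeff_zero' (by
    rw [← PowerSeries.coeff_zero_eq_constantCoeff_apply]
    simp [zetaExponent])

/-- The Artin-Mazur zeta function `ζ_f(t) = exp (∑_{n ≥ 1} (N_n(f) / n) t^n)`,
a formal power series in `t`. -/
noncomputable def artinMazurZeta {X : Type*} [TopologicalSpace X] (f : X → X) : PowerSeries ℚ :=
  PowerSeries.subst (zetaExponent f) (PowerSeries.exp ℚ)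

/-! ### Post-critically finite and hyperbolic real polynomials -/

/-- The real critical points of a real polynomial. -/
def critSet (P : ℝ[X]) : Set ℝ := {c | P.derivative.eval c = 0}

/-- The polynomial map `ℝ → ℝ` is post-critically finite (PCF):
the union of the forward orbits of its critical points is finite. -/
def IsPCF (P : ℝ[X]) : Prop :=
  (⋃ c ∈ critSet P, Set.range fun k : ℕ => (fun x => P.eval x)^[k] c).Finite

/-- `x` is an attracting periodic point of `f`, of (not necessarily minimal) period `n ≥ 1`:
`f^n(x) = x` and the multiplier `(f^n)'(x)` has absolute value `< 1`. -/
def IsAttractingPeriodicPt (f : ℝ → ℝ) (n : ℕ) (x : ℝ) : Prop :=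
  1 ≤ n ∧ f^[n] x = x ∧ |deriv f^[n] x| < 1

/-- `y` is asymptotic to the cycle of the point `x` of period `n`:
`f^{kn+m}(y) → x` as `k → ∞`, for some `m`. -/
def IsAsymptoticTo (f : ℝ → ℝ) (y : ℝ) (n : ℕ) (x : ℝ) : Prop :=
  ∃ m : ℕ, Tendsto (fun k : ℕ => f^[k * n + m] y) atTop (𝓝 x)

/-- The polynomial map `ℝ → ℝ` is hyperbolic: every critical point is asymptotic to an
attracting periodic cycle or escapes to infinity. -/
def IsHyperbolicPoly (P : ℝ[X]) : Prop :=
  ∀ c ∈ critSet P,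
    (∃ n x, IsAttractingPeriodicPt (fun y => P.eval y) n x ∧
      IsAsymptoticTo (fun y => P.eval y) c n x) ∨
    Tendsto (fun k : ℕ => |(fun y => P.eval y)^[k] c|) atTop atTop

/-! ### The family of cubics -/

/-- `a(s) = -1 + 1 / (s² (s + 1))`. -/
noncomputable def cubicA (s : ℝ) : ℝ := -1 + 1 / (s ^ 2 * (s + 1))

/-- `b(s) = -s - 1 / (s² (s + 1))`. -/
noncomputable def cubicB (s : ℝ) : ℝ := -s - 1 / (s ^ 2 * (s + 1))

/-- `F_s(x) = a(s) x³ + b(s) x² + 1`. -/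
noncomputable def cubicF (s : ℝ) : ℝ[X] := C (cubicA s) * X ^ 3 + C (cubicB s) * X ^ 2 + 1

/-! For every s the critical point 0 lies on the 3-cycle 0 → 1 → -s → 0. For s ≥ 1 the inequality in
`GoodParam` says that the other critical point c(s) is at most -s. Then F_s maps [-s, 0]
monotonically onto [0, 1] and [0, 1] monotonically onto [-s, 1]: a Markov partition for the golden
mean shift, the same for all these s.

Periodic points fall into three classes. Off the critical cycle but inside (-s, 1), each admissible
word with equal first and last letters is realised by a fixed point of F_s^n (`exists_innerFixed`),
and by only one, because F_s strictly expands the hyperbolic metrics of (-s, 0) and (0, 1) along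
equal sign itineraries (`hypCoord_expand`, `injOn_signWord`). This gives Lucas numbers, hence the
factor 1 - t - t². The critical cycle gives 1 - t³. Outside [-s, 1] Euclidean expansion leaves
exactly one 2-cycle (`fixed_outside_iff`), which gives 1 - t². A logarithmic derivative turns the
counts into the zeta function (`artinMazurZeta_eq_of_card`).

The count does not see the orbit of c(s), which stays in [-s, 1] from its first image on. Its second
image moves from 0 at s = 1 to 1 at the right endpoint, where c(s) = -s. The intermediate value
theorem on nested parameter intervals, followed by compactness, realises every admissible itinerary
that starts in [0, 1] (`exists_param`). An itinerary that is not eventually periodic rules out a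
finite critical orbit (`not_isPCF`) and convergence to any cycle (`not_isAsymptoticTo`), and it is
determined by its parameter. There are uncountably many such itineraries. -/

/-! ### The zeta function from the fixed point counts -/

section PowerSeriesPart
open PowerSeries

theorem one_sub_X_pow_three_mul_mk :
    (1 - (PowerSeries.X : ℚ⟦X⟧) ^ 3) * PowerSeries.mk (fun m => if 3 ∣ m + 1 then (3 : ℚ) else 0)
      = PowerSeries.C 3 * PowerSeries.X ^ 2 := by
  ext n
  rw [sub_mul, one_mul, map_sub, PowerSeries.coeff_mk, PowerSeries.coeff_X_pow_mul',
    PowerSeries.coeff_C_mul, PowerSeries.coeff_X_pow]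
  rcases lt_or_ge n 3 with h | h
  · interval_cases n <;> norm_num
  · obtain ⟨k, rfl⟩ := Nat.exists_eq_add_of_le h
    have h1 : (3 ∣ 3 + k + 1) ↔ (3 ∣ k + 1) := by omega
    have h2 : ¬ (3 + k = 2) := by omega
    simp [h1, h2]

theorem one_sub_X_pow_two_mul_mk :
    (1 - (PowerSeries.X : ℚ⟦X⟧) ^ 2) * PowerSeries.mk (fun m => if 2 ∣ m + 1 then (2 : ℚ) else 0)
      = PowerSeries.C 2 * PowerSeries.X := by
  ext n
  rw [sub_mul, one_mul, map_sub, PowerSeries.coeff_mk, PowerSeries.coeff_X_pow_mul',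
    PowerSeries.coeff_C_mul, PowerSeries.coeff_X]
  rcases lt_or_ge n 2 with h | h
  · interval_cases n <;> norm_num
  · obtain ⟨k, rfl⟩ := Nat.exists_eq_add_of_le h
    have h1 : (2 ∣ 2 + k + 1) ↔ (2 ∣ k + 1) := by omega
    have h2 : ¬ (2 + k = 1) := by omega
    simp [h1, h2]

theorem one_sub_X_sub_X_pow_two_mul_mk :
    (1 - (PowerSeries.X : ℚ⟦X⟧) - PowerSeries.X ^ 2) *
        PowerSeries.mk (fun m => ((Nat.fib (m + 2) + Nat.fib m : ℕ) : ℚ))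
      = 1 + PowerSeries.C 2 * PowerSeries.X := by
  ext n
  nth_rw 1 [← pow_one (PowerSeries.X : ℚ⟦X⟧)]
  rw [sub_mul, sub_mul, one_mul, map_sub, map_sub, PowerSeries.coeff_mk,
    PowerSeries.coeff_X_pow_mul',
    PowerSeries.coeff_X_pow_mul', map_add, PowerSeries.coeff_C_mul, PowerSeries.coeff_X,
    PowerSeries.coeff_one]
  rcases lt_or_ge n 2 with h | h
  · interval_cases n <;> norm_num
  · obtain ⟨k, rfl⟩ := Nat.exists_eq_add_of_le h
    have h2 : k + 2 - 1 = k + 1 := by omega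
    have h3 : 2 + k = k + 2 := by omega
    have e1 := Nat.fib_add_two (n := k)
    have e2 := Nat.fib_add_two (n := k + 1)
    have e3 := Nat.fib_add_two (n := k + 2)
    rw [h3, h2, Nat.add_sub_cancel, PowerSeries.coeff_mk, PowerSeries.coeff_mk]
    simp only [show k + 1 + 2 = k + 3 by ring, show k + 2 + 2 = k + 4 by ring,
      show k + 1 + 1 = k + 2 by ring] at *
    rw [if_pos (by omega), if_pos (by omega), if_neg (by omega), if_neg (by omega), e3, e2]
    rw [e1]
    push_cast
    ring

/-- The exponential satisfies ζ' = ζE', and the three summands of the count are the coefficients of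
the logarithmic derivatives of the three factors. So ζ times the denominator has derivative 0 and
constant term 1. -/
theorem artinMazurZeta_eq_of_card {Y : Type*} [TopologicalSpace Y] (f : Y → Y)
    (h : ∀ m, numIsolatedFixedPts f (m + 1) =
      (if 3 ∣ m + 1 then 3 else 0) + (if 2 ∣ m + 1 then 2 else 0) +
        (Nat.fib (m + 2) + Nat.fib m)) :
    artinMazurZeta f =
      ((1 - PowerSeries.X ^ 3) * (1 - PowerSeries.X ^ 2) * (1 - PowerSeries.X - PowerSeries.X ^ 2))⁻¹ := by
  have hE : d⁄dX ℚ (zetaExponent f) =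
      PowerSeries.mk (fun m => if 3 ∣ m + 1 then (3 : ℚ) else 0) +
      PowerSeries.mk (fun m => if 2 ∣ m + 1 then (2 : ℚ) else 0) +
      PowerSeries.mk (fun m => ((Nat.fib (m + 2) + Nat.fib m : ℕ) : ℚ)) := by
    ext m
    rw [PowerSeries.coeff_derivative, zetaExponent, PowerSeries.coeff_mk, if_neg (by omega), h m]
    simp only [map_add, PowerSeries.coeff_mk]
    have : ((m : ℚ) + 1) ≠ 0 := by positivity
    push_cast
    field_simp
  have hZ : d⁄dX ℚ (artinMazurZeta f) = artinMazurZeta f * d⁄dX ℚ (zetaExponent f) := by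
    rw [artinMazurZeta, PowerSeries.derivative_subst (zetaExponent_hasSubst f),
      PowerSeries.derivative_exp]
  have hc : PowerSeries.constantCoeff (zetaExponent f) = 0 := by
    rw [← PowerSeries.coeff_zero_eq_constantCoeff_apply]
    simp [zetaExponent]
  have hZ0 : PowerSeries.constantCoeff (artinMazurZeta f) = 1 := by
    have := PowerSeries.constantCoeff_subst (zetaExponent_hasSubst f) (PowerSeries.exp ℚ)
    rw [finsum_eq_single _ 0] at this
    · simp only [PowerSeries.coeff_zero_eq_constantCoeff, PowerSeries.constantCoeff_exp, pow_zero,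
        map_one, smul_eq_mul, mul_one] at this
      exact this
    · intro n hn
      rw [map_pow]
      change _ • (PowerSeries.constantCoeff (zetaExponent f)) ^ n = 0
      rw [hc, zero_pow hn, smul_zero]
  rw [PowerSeries.eq_inv_iff_mul_eq_one (by simp)]
  apply PowerSeries.derivative.ext
  · have e1 := one_sub_X_pow_three_mul_mk
    have e2 := one_sub_X_pow_two_mul_mk
    have e3 := one_sub_X_sub_X_pow_two_mul_mk
    simp only [Derivation.leibniz, hZ, hE, map_sub, PowerSeries.derivative_one, smul_eq_mul,
      PowerSeries.derivative_pow, PowerSeries.derivative_X]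
    have c3 : (PowerSeries.C 3 : ℚ⟦X⟧) = 3 := rfl
    have c2 : (PowerSeries.C 2 : ℚ⟦X⟧) = 2 := rfl
    rw [c3] at e1
    rw [c2] at e2 e3
    simp only [zero_sub, Nat.cast_ofNat, pow_one, mul_one, Nat.add_one_sub_one]
    linear_combination (artinMazurZeta f * (1 - PowerSeries.X ^ 2) * (1 - PowerSeries.X - PowerSeries.X ^ 2)) * e1 +
      (artinMazurZeta f * (1 - PowerSeries.X ^ 3) * (1 - PowerSeries.X - PowerSeries.X ^ 2)) * e2 +
      (artinMazurZeta f * (1 - PowerSeries.X ^ 3) * (1 - PowerSeries.X ^ 2)) * e3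
  · simp [hZ0]
end PowerSeriesPart

/-! ### Words of the golden mean shift -/

/-- Admissible words with `n + 1` letters, first letter `i` and last letter `j`;
the letter `false` must be followed by `true`. -/
def goldenWords : ℕ → Bool → Bool → Finset (List Bool)
  | 0, i, j => if i = j then {[i]} else ∅
  | n + 1, false, j => (goldenWords n true j).image (List.cons false)
  | n + 1, true, j =>
      (goldenWords n false j).image (List.cons true) ∪ (goldenWords n true j).image (List.cons true)

theorem head?_of_mem_goldenWords {n : ℕ} {i j : Bool} {l : List Bool}
    (h : l ∈ goldenWords n i j) : l.head? = some i := by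
  cases n with
  | zero =>
    simp only [goldenWords] at h
    split_ifs at h
    · simp_all
    · simp at h
  | succ n =>
    cases i <;> simp [goldenWords] at h
    · obtain ⟨a, -, rfl⟩ := h; rfl
    · rcases h with ⟨a, -, rfl⟩ | ⟨a, -, rfl⟩ <;> rfl

theorem disjoint_goldenWords (n : ℕ) (j k : Bool) :
    Disjoint (goldenWords n false j) (goldenWords n true k) := by
  rw [Finset.disjoint_left]
  intro l h1 h2
  have := (head?_of_mem_goldenWords h1).symm.trans (head?_of_mem_goldenWords h2)
  simp at this

theorem card_goldenWords_succ_false (n : ℕ) (j : Bool) :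
    (goldenWords (n + 1) false j).card = (goldenWords n true j).card := by
  rw [goldenWords, Finset.card_image_of_injective _ (List.cons_injective)]

theorem card_goldenWords_succ_true (n : ℕ) (j : Bool) :
    (goldenWords (n + 1) true j).card =
      (goldenWords n false j).card + (goldenWords n true j).card := by
  rw [goldenWords, Finset.card_union_of_disjoint,
    Finset.card_image_of_injective _ (List.cons_injective),
    Finset.card_image_of_injective _ (List.cons_injective)]
  rw [Finset.disjoint_image (List.cons_injective)]
  exact disjoint_goldenWords n j j

theorem card_goldenWords_to_true (n : ℕ) :
    (goldenWords n false true).card = Nat.fib n ∧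
      (goldenWords n true true).card = Nat.fib (n + 1) := by
  induction n with
  | zero => simp [goldenWords]
  | succ n ih =>
    rw [card_goldenWords_succ_false, card_goldenWords_succ_true, ih.1, ih.2, Nat.fib_add_two]
    simp

/-- Shifted by one against the companion lemma: for single letters the first count would be the
Fibonacci number of index -1. -/
theorem card_goldenWords_to_false (n : ℕ) :
    (goldenWords (n + 1) false false).card = Nat.fib n ∧
      (goldenWords (n + 1) true false).card = Nat.fib (n + 1) := by
  induction n with
  | zero => simp [goldenWords]
  | succ n ih =>
    rw [card_goldenWords_succ_false, card_goldenWords_succ_true (n + 1), ih.1, ih.2,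
      Nat.fib_add_two]
    simp

/-- This is the trace of the (m + 1)-st power of the transition matrix, a Lucas number: m + 2
letters with equal ends code a loop of length m + 1. -/
theorem card_cyclic_goldenWords (m : ℕ) :
    (goldenWords (m + 1) false false ∪ goldenWords (m + 1) true true).card =
      Nat.fib (m + 2) + Nat.fib m := by
  rw [Finset.card_union_of_disjoint (disjoint_goldenWords _ _ _),
    (card_goldenWords_to_false m).1, (card_goldenWords_to_true (m + 1)).2]
  ring


/-! ### The cubic family for a fixed parameter -/

/-- The map `F_s` on the real line. -/
noncomputable def cubicMap (s : ℝ) : ℝ → ℝ := fun x => (cubicF s).eval x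

theorem cubicMap_apply (s x : ℝ) :
    cubicMap s x = cubicA s * x ^ 3 + cubicB s * x ^ 2 + 1 := by
  simp [cubicMap, cubicF]

theorem continuous_cubicMap (s : ℝ) : Continuous (cubicMap s) := (cubicF s).continuous

/-- The parameters between `1` and the one for which `-s` is a critical point. -/
structure GoodParam (s : ℝ) : Prop where
  one_le : 1 ≤ s
  le : s ^ 3 * (s + 1) ≤ 2 + 3 * s

namespace GoodParam

variable {s : ℝ}

/-- Both coefficients are affine in u = 1 / (s² (s + 1)), which makes later inequalities polynomial
in s and u. The last conjunct is `GoodParam.le` divided by s² (s + 1). -/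
theorem exists_u (hs : GoodParam s) : ∃ u : ℝ, 0 < u ∧ u ≤ 1 / 2 ∧ u * (s ^ 2 * (s + 1)) = 1 ∧
    cubicA s = -1 + u ∧ cubicB s = -s - u ∧ s ≤ u * (2 + 3 * s) := by
  have h1 := hs.one_le
  have hd : 2 ≤ s ^ 2 * (s + 1) := by nlinarith [sq_nonneg (s - 1)]
  refine ⟨1 / (s ^ 2 * (s + 1)), by positivity, ?_, ?_, rfl, rfl, ?_⟩
  · exact one_div_le_one_div_of_le (by norm_num) hd
  · field_simp
  · rw [div_mul_eq_mul_div, le_div_iff₀ (by positivity)]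
    nlinarith [hs.le]

theorem le_three_halves (hs : GoodParam s) : s ≤ 3 / 2 := by
  by_contra! h
  have h3 : 27 / 8 * s ≤ s ^ 3 * s := by
    have : (27 / 8 : ℝ) ≤ s ^ 3 := by nlinarith [mul_pos (sub_pos.2 h) (sub_pos.2 h)]
    nlinarith
  nlinarith [hs.le, pow_pos (show 0 < s by linarith) 3, mul_pos (sub_pos.2 h) (sub_pos.2 h)]

theorem map_zero : cubicMap s 0 = 1 := by simp [cubicMap_apply]

theorem map_one (hs : GoodParam s) : cubicMap s 1 = -s := by
  obtain ⟨u, -, -, -, ha, hb, -⟩ := hs.exists_u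
  rw [cubicMap_apply, ha, hb]; ring

theorem map_neg (hs : GoodParam s) : cubicMap s (-s) = 0 := by
  obtain ⟨u, -, -, hu, ha, hb, -⟩ := hs.exists_u
  rw [cubicMap_apply, ha, hb]; linear_combination -hu

theorem monotoneOn (hs : GoodParam s) : MonotoneOn (cubicMap s) (Set.Icc (-s) 0) := by
  obtain ⟨u, hu0, hu1, hu, ha, hb, hu2⟩ := hs.exists_u
  have h1 := hs.one_le
  intro x hx y hy hxy
  obtain ⟨hx1, hx2⟩ := hx
  obtain ⟨hy1, hy2⟩ := hy
  rw [cubicMap_apply, cubicMap_apply, ha, hb, ← sub_nonneg]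
  have key : 0 ≤ -(1 - u) * (x ^ 2 + x * y + y ^ 2) - (s + u) * (x + y) := by
    -- The chord slope is nonnegative; the extreme case is x = y = -s, where it becomes `e2`, the
    -- upper bound of `GoodParam` in terms of u.
    have e1 : x ^ 2 + x * y + y ^ 2 ≤ -(3 / 2 * s * (x + y)) := by nlinarith
    have e2 : 3 * s * (1 - u) ≤ 2 * (s + u) := by linarith
    nlinarith
  have := mul_nonneg (sub_nonneg.2 hxy) key
  linarith

theorem antitoneOn (hs : GoodParam s) : AntitoneOn (cubicMap s) (Set.Ici 0) := by
  obtain ⟨u, hu0, hu1, hu, ha, hb, hu2⟩ := hs.exists_u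
  have h1 := hs.one_le
  intro x hx y hy hxy
  simp only [Set.mem_Ici] at hx hy
  rw [cubicMap_apply, cubicMap_apply, ha, hb, ← sub_nonneg]
  have key : 0 ≤ (1 - u) * (x ^ 2 + x * y + y ^ 2) + (s + u) * (x + y) := by
    have : 0 ≤ 1 - u := by linarith
    positivity
  have := mul_nonneg (sub_nonneg.2 hxy) key
  linarith

theorem mapsTo_left (hs : GoodParam s) {x : ℝ} (hx : x ∈ Set.Icc (-s) 0) :
    cubicMap s x ∈ Set.Icc (0 : ℝ) 1 := by
  have h1 := hs.one_le
  constructor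
  · rw [← hs.map_neg]; exact hs.monotoneOn ⟨le_rfl, by linarith⟩ hx hx.1
  · rw [← map_zero (s := s)]; exact hs.monotoneOn hx ⟨by linarith, le_rfl⟩ hx.2

theorem mapsTo_right (hs : GoodParam s) {x : ℝ} (hx : x ∈ Set.Icc (0 : ℝ) 1) :
    cubicMap s x ∈ Set.Icc (-s) 1 := by
  constructor
  · rw [← hs.map_one]; exact hs.antitoneOn hx.1 (by simp) hx.2
  · rw [← map_zero (s := s)]; exact hs.antitoneOn (by simp) hx.1 hx.1

theorem mapsTo (hs : GoodParam s) : Set.MapsTo (cubicMap s) (Set.Icc (-s) 1) (Set.Icc (-s) 1) := by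
  have h1 := hs.one_le
  intro x hx
  rcases le_total x 0 with h | h
  · have := hs.mapsTo_left ⟨hx.1, h⟩
    exact ⟨by linarith [this.1], this.2⟩
  · exact hs.mapsTo_right ⟨h, hx.2⟩

/-! ### The second critical point and its critical value -/

/-- The critical point other than `0`. -/
noncomputable def _root_.cubicCrit (s : ℝ) : ℝ := -2 * cubicB s / (3 * cubicA s)

theorem cubicA_neg (hs : GoodParam s) : cubicA s < 0 := by
  obtain ⟨u, hu0, hu1, hu, ha, hb, hu2⟩ := hs.exists_u
  linarith

theorem cubicA_mul_crit (hs : GoodParam s) : 3 * cubicA s * cubicCrit s = -2 * cubicB s := by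
  have := hs.cubicA_neg.ne
  rw [cubicCrit]; field_simp

theorem crit_le (hs : GoodParam s) : cubicCrit s ≤ -s := by
  obtain ⟨u, hu0, hu1, hu, ha, hb, hu2⟩ := hs.exists_u
  have h := hs.cubicA_mul_crit
  have ha0 := hs.cubicA_neg
  by_contra! hc
  have : 3 * cubicA s * cubicCrit s < 3 * cubicA s * (-s) := by nlinarith
  rw [h, ha, hb] at this
  linarith

/-- Keeps the second critical value inside [-s, 1]. The value of the cubic at c is 1 + 4b³ / (27a²),
so the claim reduces to a polynomial inequality in s, with equality at s = 1. -/
theorem neg_le_map_crit (hs : GoodParam s) : -s ≤ cubicMap s (cubicCrit s) := by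
  have h := hs.cubicA_mul_crit
  have ha0 := hs.cubicA_neg
  have h32 := hs.le_three_halves
  have h1 := hs.one_le
  obtain ⟨u, hu0, hu1, hu, ha, hb, hu2⟩ := hs.exists_u
  have e : cubicA s ^ 2 * (cubicMap s (cubicCrit s) + s) =
      4 / 27 * cubicB s ^ 3 + (1 + s) * cubicA s ^ 2 := by
    rw [cubicMap_apply]
    have hc : cubicCrit s = -2 * cubicB s / (3 * cubicA s) := rfl
    have := ha0.ne
    rw [hc]
    field_simp
    ring
  have key : 0 ≤ 4 / 27 * cubicB s ^ 3 + (1 + s) * cubicA s ^ 2 := by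
    rw [ha, hb]
    have hp : 4 * (s ^ 4 + s ^ 3 + 1) ^ 3 ≤ 27 * (s ^ 3 + s ^ 2 - 1) ^ 2 * (s ^ 2 * (s + 1) ^ 2) := by
      -- In powers of t = s - 1 the difference of the two sides has no constant term and positive
      -- coefficients up to t⁶. The negative higher terms are absorbed by 6909 t⁶ because t ≤ 1/2;
      -- 4284 is the sum of their absolute coefficients.
      obtain ⟨t, rfl⟩ : ∃ t, s = 1 + t := ⟨s - 1, by ring⟩
      have t0 : 0 ≤ t := by linarith
      have t1 : t ≤ 1 / 2 := by linarith
      have t2 : ∀ n, t ^ n ≤ 1 := fun n => pow_le_one₀ t0 (by linarith)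
      have hK : 354 + 2199 * t + 1286 * t ^ 2 + 381 * t ^ 3 + 60 * t ^ 4 + 4 * t ^ 5 ≤ 4284 := by
        linarith [t2 2, t2 3, t2 4, t2 5]
      have hK0 : 0 ≤ 354 + 2199 * t + 1286 * t ^ 2 + 381 * t ^ 3 + 60 * t ^ 4 + 4 * t ^ 5 := by
        positivity
      have hL : 0 ≤ t ^ 6 * (6909 -
          t * (354 + 2199 * t + 1286 * t ^ 2 + 381 * t ^ 3 + 60 * t ^ 4 + 4 * t ^ 5)) :=
        mul_nonneg (by positivity) (by nlinarith)
      have hM : 0 ≤ t * (648 + 4419 * t + 12452 * t ^ 2 + 18810 * t ^ 3 + 16158 * t ^ 4) := by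
        positivity
      linarith
    have hd : 0 < s ^ 2 * (s + 1) := by positivity
    have hu' : u = 1 / (s ^ 2 * (s + 1)) := by field_simp; linarith
    have e2 : 27 * (s ^ 2 * (s + 1)) ^ 3 *
        (4 / 27 * (-s - u) ^ 3 + (1 + s) * (-1 + u) ^ 2) =
        27 * (s ^ 3 + s ^ 2 - 1) ^ 2 * (s ^ 2 * (s + 1) ^ 2) - 4 * (s ^ 4 + s ^ 3 + 1) ^ 3 := by
      rw [hu']; field_simp; ring
    by_contra! hn
    have := mul_neg_of_pos_of_neg (show 0 < 27 * (s ^ 2 * (s + 1)) ^ 3 by positivity) hn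
    linarith
  rw [← e] at key
  have := nonneg_of_mul_nonneg_right key (sq_pos_of_neg ha0)
  linarith

/-- F - F(c) has a double zero at c, and its third zero -c/2 is positive. -/
theorem map_crit_le (hs : GoodParam s) {x : ℝ} (hx : x ≤ 0) :
    cubicMap s (cubicCrit s) ≤ cubicMap s x := by
  have h := hs.cubicA_mul_crit
  have ha0 := hs.cubicA_neg
  have hc := hs.crit_le
  have h1 := hs.one_le
  have e : cubicMap s x - cubicMap s (cubicCrit s) =
      (-cubicA s) * (x - cubicCrit s) ^ 2 * (-cubicCrit s / 2 - x) := by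
    rw [cubicMap_apply, cubicMap_apply]
    linear_combination (1 / 2) * (x ^ 2 - cubicCrit s ^ 2) * h
  have : 0 ≤ (-cubicA s) * (x - cubicCrit s) ^ 2 * (-cubicCrit s / 2 - x) :=
    mul_nonneg (mul_nonneg (by linarith) (sq_nonneg _)) (by linarith)
  linarith

theorem neg_le_map (hs : GoodParam s) {x : ℝ} (hx : x ≤ 0) : -s ≤ cubicMap s x :=
  hs.neg_le_map_crit.trans (hs.map_crit_le hx)

theorem map_crit_nonpos (hs : GoodParam s) : cubicMap s (cubicCrit s) ≤ 0 := by
  rw [← hs.map_neg]; exact hs.map_crit_le (by linarith [hs.one_le])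

/-! ### Expansion of the hyperbolic metric -/

/-- The hyperbolic coordinate on `(-s, 0)` and on `(0, 1)`. -/
noncomputable def _root_.hypCoord (s x : ℝ) : ℝ :=
  if 0 < x then Real.log (x / (1 - x)) else Real.log ((x + s) / -x)

theorem _root_.abs_sub_lt_of_div {a b c d : ℝ} (ha : 0 < a) (hab : a < b) (hc : 0 < c)
    (h : b * c < a * d) : |Real.log a - Real.log b| < |Real.log c - Real.log d| := by
  have hb := ha.trans hab
  have hd : 0 < d := by
    have : 0 < a * d := lt_trans (by positivity) h
    exact (pos_iff_pos_of_mul_pos this).1 ha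
  have h1 : Real.log a < Real.log b := Real.log_lt_log ha hab
  have h2 := Real.log_lt_log (mul_pos hb hc) h
  rw [Real.log_mul hb.ne' hc.ne', Real.log_mul ha.ne' hd.ne'] at h2
  rw [abs_sub_comm, abs_of_pos (by linarith), abs_sub_comm, abs_of_pos (by linarith)]
  linarith

/-- The branch sends -s to 0 and 0 to 1, so the factors z + s of F(z) and -z of 1 - F(z) cancel
against the hyperbolic coordinate. What remains is a difference of quotients divisible by y - x,
with a cofactor that must be shown positive. -/
theorem hypCoord_lt_left (hs : GoodParam s) {x y : ℝ} (hx : -s < x) (hxy : x < y) (hy : y < 0)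
    (hfx : 0 < cubicMap s x) (hfx1 : cubicMap s x < 1) (hfy : 0 < cubicMap s y)
    (hfy1 : cubicMap s y < 1) :
    |hypCoord s x - hypCoord s y| <
      |hypCoord s (cubicMap s x) - hypCoord s (cubicMap s y)| := by
  rw [hypCoord, hypCoord, hypCoord, hypCoord, if_neg (by linarith), if_neg (by linarith),
    if_pos hfx, if_pos hfy]
  have hx0 : 0 < -x := by linarith
  have hy0 : 0 < -y := by linarith
  apply abs_sub_lt_of_div
  · exact div_pos (by linarith) hx0
  · rw [div_lt_div_iff₀ hx0 hy0]; nlinarith [hs.one_le]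
  · exact div_pos hfx (by linarith)
  · rw [div_mul_div_comm, div_mul_div_comm, div_lt_div_iff₀
      (mul_pos hy0 (by linarith)) (mul_pos hx0 (by linarith))]
    obtain ⟨u, hu0, hu1, hu, ha, hb, hu2⟩ := hs.exists_u
    have h1 := hs.one_le
    have hQ : ∀ z, cubicMap s z = (z + s) * (cubicA s * z ^ 2 - z / s ^ 2 + 1 / s) := by
      intro z
      have hu' : u = 1 / (s ^ 2 * (s + 1)) := by field_simp; linarith
      rw [cubicMap_apply, ha, hb, hu']; field_simp; ring
    have hD : ∀ z, 1 - cubicMap s z = -z * (cubicA s * z ^ 2 + cubicB s * z) := by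
      intro z; rw [cubicMap_apply]; ring
    have hkey : 0 < (y - x) * (cubicA s ^ 2 * s * (x * y) -
        1 / s * (cubicA s * (x + y) + cubicB s)) := by
      apply mul_pos (by linarith)
      have : 0 < s * (cubicA s ^ 2 * s * (x * y) - 1 / s * (cubicA s * (x + y) + cubicB s)) := by
        have : s * (cubicA s ^ 2 * s * (x * y) - 1 / s * (cubicA s * (x + y) + cubicB s)) =
          cubicA s ^ 2 * s ^ 2 * (x * y) - cubicA s * (x + y) - cubicB s := by
          field_simp; ring
        rw [this, ha, hb]
        -- The cofactor is affine in x and in y separately. Hence s² times it is the bilinear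
        -- interpolation of its values at (0, 0), (-s, 0), (0, -s) and (-s, -s), namely s + u, u (1
        -- + s) twice, and the expression in `i3`.
        have i1 : 0 < (s + x) * (s + y) * (s + u) :=
          mul_pos (mul_pos (by linarith) (by linarith)) (by linarith)
        have i2 : 0 < (-x * (s + y) + (s + x) * -y) * (u * (1 + s)) :=
          mul_pos (add_pos (mul_pos hx0 (by linarith)) (mul_pos (by linarith) hy0))
            (mul_pos hu0 (by linarith))
        have i3 : 0 < ((1 - u) * s) ^ 2 * s ^ 2 - 2 * ((1 - u) * s) + s + u := by
          have : ((1 - u) * s) ^ 2 ≤ ((1 - u) * s) ^ 2 * s ^ 2 :=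
            le_mul_of_one_le_right (sq_nonneg _) (one_le_pow₀ h1)
          nlinarith [sq_nonneg ((1 - u) * s - 1)]
        have i4 := mul_pos (mul_pos hx0 hy0) i3
        have i5 : 0 < s ^ 2 * ((-1 + u) ^ 2 * s ^ 2 * (x * y) - (-1 + u) * (x + y) - (-s - u)) := by
          linarith
        exact (pos_iff_pos_of_mul_pos i5).1 (by positivity)
      exact (pos_iff_pos_of_mul_pos this).1 (by linarith)
    have e : (cubicA s * y ^ 2 - y / s ^ 2 + 1 / s) * (cubicA s * x ^ 2 + cubicB s * x) -
        (cubicA s * x ^ 2 - x / s ^ 2 + 1 / s) * (cubicA s * y ^ 2 + cubicB s * y) =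
        (y - x) * (cubicA s ^ 2 * s * (x * y) -
        1 / s * (cubicA s * (x + y) + cubicB s)) := by
      have hu' : u = 1 / (s ^ 2 * (s + 1)) := by field_simp; linarith
      rw [ha, hb, hu']; field_simp; ring
    rw [hD x, hD y, hQ x, hQ y]
    have hp : 0 < (x + s) * (y + s) * (-x) * (-y) := by
      have : 0 < x + s := by linarith
      have : 0 < y + s := by linarith
      positivity
    have := mul_pos hp (e ▸ hkey)
    linarith

/-- Two expansions are composed: from (0, 1) to the metric of its image (-s, 1), and from there to
the larger metric of the subinterval (-s, 0) or (0, 1) that contains both image points. -/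
theorem hypCoord_lt_right (hs : GoodParam s) {x y : ℝ} (hx : 0 < x) (hxy : x < y) (hy : y < 1)
    (hfx : -s < cubicMap s x) (hfx1 : cubicMap s x < 1) (hfy : -s < cubicMap s y)
    (hfy1 : cubicMap s y < 1) (hsign : 0 < cubicMap s x ↔ 0 < cubicMap s y)
    (hfx0 : cubicMap s x ≠ 0) (hfy0 : cubicMap s y ≠ 0) :
    |hypCoord s x - hypCoord s y| <
      |hypCoord s (cubicMap s x) - hypCoord s (cubicMap s y)| := by
  have h1 := hs.one_le
  have hanti : cubicMap s y ≤ cubicMap s x := hs.antitoneOn hx.le (hx.trans hxy).le hxy.le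
  have hR : ∀ z, cubicMap s z + s = (1 - z) * (-cubicA s * z ^ 2 + (1 + s) * z + (1 + s)) := by
    intro z
    obtain ⟨u, -, -, -, ha, hb, -⟩ := hs.exists_u
    rw [cubicMap_apply, ha, hb]; ring
  have hE : ∀ z, 1 - cubicMap s z = z * (-cubicA s * z ^ 2 - cubicB s * z) := by
    intro z; rw [cubicMap_apply]; ring
  -- the cross ratio with respect to `(-s, 1)`
  have hK : (y / (1 - y)) * ((cubicMap s y + s) / (1 - cubicMap s y)) <
      (x / (1 - x)) * ((cubicMap s x + s) / (1 - cubicMap s x)) := by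
    have hy0 : 0 < y := hx.trans hxy
    have hx1 : 0 < 1 - x := by linarith
    have hy1 : 0 < 1 - y := by linarith
    rw [div_mul_div_comm, div_mul_div_comm, div_lt_div_iff₀
      (mul_pos hy1 (by linarith)) (mul_pos hx1 (by linarith)), hR x, hR y, hE x, hE y]
    obtain ⟨u, hu0, hu1, hu, ha, hb, hu2⟩ := hs.exists_u
    have hkey : 0 < (y - x) * (-cubicA s * (1 + s) * (x + y) +
        -cubicA s * (1 + s + cubicB s) * (x * y) + -cubicB s * (1 + s)) := by
      have hα : 0 < -cubicA s := by linarith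
      have hβ : 0 < -cubicB s := by linarith
      have hγ : 0 < 1 + s + cubicB s := by linarith
      have hδ : 0 < y - x := by linarith
      have : 0 < 1 + s := by linarith
      positivity
    have hp : 0 < x * y * (1 - x) * (1 - y) := by positivity
    have := mul_pos hp hkey
    linarith
  have hlt : cubicMap s y < cubicMap s x := by
    refine lt_of_le_of_ne hanti fun h => ?_
    have hxy' : x / (1 - x) < y / (1 - y) := by
      rw [div_lt_div_iff₀ (by linarith) (by linarith)]; nlinarith
    rw [h] at hK
    have : 0 < (cubicMap s x + s) / (1 - cubicMap s x) := div_pos (by linarith) (by linarith)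
    nlinarith
  generalize cubicMap s x = p at *
  generalize cubicMap s y = q at *
  have hxpos : 0 < x / (1 - x) := div_pos hx (by linarith)
  have hypos : 0 < y / (1 - y) := div_pos (by linarith) (by linarith)
  have hxy' : x / (1 - x) < y / (1 - y) := by
    rw [div_lt_div_iff₀ (by linarith) (by linarith)]; nlinarith
  rw [hypCoord, hypCoord, if_pos hx, if_pos (hx.trans hxy)]
  generalize x / (1 - x) = X at *
  generalize y / (1 - y) = Y at *
  have hK' : Y * ((q + s) * (1 - p)) < X * ((p + s) * (1 - q)) := by
    rw [mul_div_assoc', mul_div_assoc', div_lt_div_iff₀ (by linarith) (by linarith)] at hK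
    linarith
  rw [abs_sub_comm (hypCoord s p)]
  by_cases hp : 0 < p
  · have hq := hsign.1 hp
    rw [hypCoord, hypCoord, if_pos hp, if_pos hq]
    apply abs_sub_lt_of_div hxpos hxy'
    · exact div_pos hq (by linarith)
    · rw [mul_div_assoc', mul_div_assoc', div_lt_div_iff₀ (by linarith) (by linarith)]
      -- `q / p ≤ (q + s) / (p + s)`
      have i1 : q * (p + s) ≤ p * (q + s) := by nlinarith
      have i2 : Y * (q + s) * (1 - p) * q < X * (p + s) * (1 - q) * q := by nlinarith
      have i3 : X * (1 - q) * (q * (p + s)) ≤ X * (1 - q) * (p * (q + s)) :=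
        mul_le_mul_of_nonneg_left i1 (mul_nonneg hxpos.le (by linarith))
      have i4 : (q + s) * (Y * q * (1 - p)) < (q + s) * (X * p * (1 - q)) := by linarith
      exact lt_of_mul_lt_mul_left i4 (by linarith)
  · have hq : ¬ 0 < q := fun h => hp (hsign.2 h)
    rw [hypCoord, hypCoord, if_neg hp, if_neg hq]
    have hp' : p < 0 := lt_of_le_of_ne (not_lt.1 hp) hfx0
    have hq' : q < 0 := lt_of_le_of_ne (not_lt.1 hq) hfy0
    apply abs_sub_lt_of_div hxpos hxy'
    · exact div_pos (by linarith) (by linarith)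
    · rw [mul_div_assoc', mul_div_assoc', div_lt_div_iff₀ (by linarith) (by linarith)]
      have i1 : (1 - q) * -p ≤ (1 - p) * -q := by nlinarith
      have i2 : Y * (q + s) * (1 - p) * -p < X * (p + s) * (1 - q) * -p := by nlinarith
      have i3 : X * (p + s) * ((1 - q) * -p) ≤ X * (p + s) * ((1 - p) * -q) :=
        mul_le_mul_of_nonneg_left i1 (mul_nonneg hxpos.le (by linarith))
      have i4 : (1 - p) * (Y * (q + s) * -p) < (1 - p) * (X * (p + s) * -q) := by linarith
      exact lt_of_mul_lt_mul_left i4 (by linarith)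

/-- `F_s` strictly expands the hyperbolic metric along pairs with the same signs. -/
theorem hypCoord_expand (hs : GoodParam s) {x y : ℝ} (hne : x ≠ y)
    (hx : x ∈ Set.Ioo (-s) 1) (hy : y ∈ Set.Ioo (-s) 1)
    (hfx : cubicMap s x ∈ Set.Ioo (-s) 1) (hfy : cubicMap s y ∈ Set.Ioo (-s) 1)
    (hx0 : x ≠ 0) (hy0 : y ≠ 0) (hfx0 : cubicMap s x ≠ 0) (hfy0 : cubicMap s y ≠ 0)
    (hsign : 0 < x ↔ 0 < y) (hfsign : 0 < cubicMap s x ↔ 0 < cubicMap s y) :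
    |hypCoord s x - hypCoord s y| <
      |hypCoord s (cubicMap s x) - hypCoord s (cubicMap s y)| := by
  wlog h : x < y generalizing x y
  · have := this hne.symm hy hx hfy hfx hy0 hx0 hfy0 hfx0 hsign.symm hfsign.symm
      (lt_of_le_of_ne (not_lt.1 h) hne.symm)
    rwa [abs_sub_comm, abs_sub_comm (hypCoord s (cubicMap s x))]
  by_cases hp : 0 < x
  · exact hs.hypCoord_lt_right hp h hy.2 hfx.1 hfx.2 hfy.1 hfy.2 hfsign hfx0 hfy0
  · have hx' : x < 0 := lt_of_le_of_ne (not_lt.1 hp) hx0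
    have hy' : y < 0 := lt_of_le_of_ne (not_lt.1 fun h => hp (hsign.2 h)) hy0
    exact hs.hypCoord_lt_left hx.1 h hy'
      (lt_of_le_of_ne (hs.mapsTo_left ⟨hx.1.le, hx'.le⟩).1 hfx0.symm) hfx.2
      (lt_of_le_of_ne (hs.mapsTo_left ⟨hy.1.le, hy'.le⟩).1 hfy0.symm) hfy.2

end GoodParam


namespace GoodParam
variable {s : ℝ}

/-! ### The critical cycle -/

theorem mapsTo_critCycle (hs : GoodParam s) :
    Set.MapsTo (cubicMap s) {0, 1, -s} {0, 1, -s} := by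
  rintro x (rfl | rfl | rfl)
  · simp [map_zero]
  · simp [hs.map_one]
  · simp [hs.map_neg]

theorem iterate_critCycle_iff (hs : GoodParam s) {z : ℝ} (hz : z ∈ ({0, 1, -s} : Set ℝ)) (n : ℕ) :
    (cubicMap s)^[n] z = z ↔ 3 ∣ n := by
  have h1 := hs.one_le
  have h3 : Function.IsPeriodicPt (cubicMap s) 3 z := by
    rcases hz with rfl | rfl | rfl <;>
    simp [Function.IsPeriodicPt, Function.IsFixedPt, map_zero, hs.map_one, hs.map_neg]
  have h0 : ¬ Function.IsFixedPt (cubicMap s) z := by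
    rcases hz with rfl | rfl | rfl <;> simp [Function.IsFixedPt, map_zero, hs.map_one, hs.map_neg]
    · intro h; linarith
    · intro h; linarith
  have hm : Function.minimalPeriod (cubicMap s) z = 3 := by
    have : Fact (Nat.Prime 3) := ⟨Nat.prime_three⟩
    exact Function.minimalPeriod_eq_prime h3 h0
  rw [← hm, ← Function.isPeriodicPt_iff_minimalPeriod_dvd]
  rfl

theorem hasDerivAt (x : ℝ) :
    HasDerivAt (cubicMap s) ((cubicF s).derivative.eval x) x :=
  (cubicF s).hasDerivAt x

theorem eval_derivative (x : ℝ) :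
    (cubicF s).derivative.eval x = x * (3 * cubicA s * x + 2 * cubicB s) := by
  simp [cubicF]; ring

/-- The cycle passes through the critical point 0, so the chain rule has a zero factor. -/
theorem hasDerivAt_iterate_critCycle (hs : GoodParam s) {z : ℝ}
    (hz : z ∈ ({0, 1, -s} : Set ℝ)) {n : ℕ} (hn : n ≠ 0) (hfix : (cubicMap s)^[n] z = z) :
    HasDerivAt (cubicMap s)^[n] 0 z := by
  obtain ⟨k, rfl⟩ := (hs.iterate_critCycle_iff hz n).1 hfix
  have h3 : (cubicMap s)^[3] z = z := (hs.iterate_critCycle_iff hz 3).2 dvd_rfl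
  have hd : HasDerivAt (cubicMap s)^[3] 0 z := by
    have := (hasDerivAt (s := s) (cubicMap s (cubicMap s z))).comp z
      ((hasDerivAt (s := s) (cubicMap s z)).comp z (hasDerivAt (s := s) z))
    have e : (cubicF s).derivative.eval (cubicMap s (cubicMap s z)) *
        ((cubicF s).derivative.eval (cubicMap s z) * (cubicF s).derivative.eval z) = 0 := by
      rcases hz with rfl | rfl | rfl <;>
        simp [eval_derivative, map_zero, hs.map_one, hs.map_neg]
    rw [e] at this
    exact this
  have := HasDerivAt.iterate z hd h3 k
  rw [← Function.iterate_mul, zero_pow (by rintro rfl; simp at hn)] at this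
  exact this

/-! ### Itineraries -/

/-- The intervals `[-s, 0]` and `[0, 1]`. -/
def _root_.goldenPiece (s : ℝ) (i : Bool) : Set ℝ :=
  Set.Icc (bif i then 0 else -s) (bif i then 1 else 0)

/-- The point `x` follows the word `l`. -/
def _root_.Follows (s : ℝ) : List Bool → ℝ → Prop
  | [], _ => True
  | i :: l, x => x ∈ goldenPiece s i ∧ Follows s l (cubicMap s x)

/-- The sign itinerary of length `n + 1`. -/
noncomputable def _root_.signWord (s : ℝ) : ℕ → ℝ → List Bool
  | 0, x => [decide (0 < x)]
  | n + 1, x => decide (0 < x) :: signWord s n (cubicMap s x)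

theorem exists_pullback_left (hs : GoodParam s) {a b : ℝ} (hab : a < b)
    (hJ : Set.Icc a b ⊆ Set.Icc 0 1) :
    ∃ c d, c < d ∧ Set.Icc c d ⊆ Set.Icc (-s) 0 ∧ cubicMap s c = a ∧ cubicMap s d = b ∧
      Set.MapsTo (cubicMap s) (Set.Icc c d) (Set.Icc a b) := by
  have h1 := hs.one_le
  have hsurj := intermediate_value_Icc (show -s ≤ 0 by linarith)
    (continuous_cubicMap s).continuousOn
  rw [hs.map_neg, map_zero] at hsurj
  obtain ⟨c, hc, hca⟩ := hsurj (hJ (Set.left_mem_Icc.2 hab.le))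
  obtain ⟨d, hd, hdb⟩ := hsurj (hJ (Set.right_mem_Icc.2 hab.le))
  have hcd : c < d := by
    by_contra! h
    have := hs.monotoneOn hd hc h
    linarith
  have hsub : Set.Icc c d ⊆ Set.Icc (-s) 0 := Set.Icc_subset_Icc hc.1 hd.2
  refine ⟨c, d, hcd, hsub, hca, hdb, fun x hx => ⟨?_, ?_⟩⟩
  · rw [← hca]; exact hs.monotoneOn hc (hsub hx) hx.1
  · rw [← hdb]; exact hs.monotoneOn (hsub hx) hd hx.2

theorem exists_pullback_right (hs : GoodParam s) {a b : ℝ} (hab : a < b)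
    (hJ : Set.Icc a b ⊆ Set.Icc (-s) 1) :
    ∃ c d, c < d ∧ Set.Icc c d ⊆ Set.Icc 0 1 ∧ cubicMap s c = b ∧ cubicMap s d = a ∧
      Set.MapsTo (cubicMap s) (Set.Icc c d) (Set.Icc a b) := by
  have hsurj := intermediate_value_Icc' (show (0 : ℝ) ≤ 1 by norm_num)
    (continuous_cubicMap s).continuousOn
  rw [hs.map_one, map_zero] at hsurj
  obtain ⟨d, hd, hda⟩ := hsurj (hJ (Set.left_mem_Icc.2 hab.le))
  obtain ⟨c, hc, hcb⟩ := hsurj (hJ (Set.right_mem_Icc.2 hab.le))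
  have hcd : c < d := by
    by_contra! h
    have := hs.antitoneOn hd.1 hc.1 h
    linarith
  have hsub : Set.Icc c d ⊆ Set.Icc 0 1 := Set.Icc_subset_Icc hc.1 hd.2
  refine ⟨c, d, hcd, hsub, hcb, hda, fun x hx => ⟨?_, ?_⟩⟩
  · rw [← hda]; exact hs.antitoneOn (hsub hx).1 hd.1 hx.2
  · rw [← hcb]; exact hs.antitoneOn hc.1 (hsub hx).1 hx.1

theorem goldenPiece_subset (hs : GoodParam s) (i : Bool) :
    goldenPiece s i ⊆ Set.Icc (-s) 1 := by
  have h1 := hs.one_le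
  cases i
  · exact Set.Icc_subset_Icc le_rfl zero_le_one
  · exact Set.Icc_subset_Icc (show -s ≤ 0 by linarith) le_rfl

/-- Pull the last piece back through the monotone branches named by the word. Only the endpoint
values of F^n on the cylinder are recorded, in either order, since the right branch reverses
orientation. -/
theorem exists_cylinder (hs : GoodParam s) (n : ℕ) : ∀ (i j : Bool) (l : List Bool),
    l ∈ goldenWords n i j → ∃ a b, a < b ∧ Set.Icc a b ⊆ goldenPiece s i ∧
      (∀ x ∈ Set.Icc a b, Follows s l x) ∧
      (((cubicMap s)^[n] a = (bif j then 0 else -s) ∧ (cubicMap s)^[n] b = bif j then 1 else 0) ∨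
       ((cubicMap s)^[n] b = (bif j then 0 else -s) ∧
          (cubicMap s)^[n] a = bif j then 1 else 0)) := by
  have h1 := hs.one_le
  induction n with
  | zero =>
    intro i j l hl
    simp only [goldenWords] at hl
    split_ifs at hl with hij
    · subst hij
      rw [Finset.mem_singleton] at hl
      subst hl
      refine ⟨bif i then 0 else -s, bif i then 1 else 0, ?_, Set.Subset.rfl,
        fun x hx => ⟨hx, trivial⟩, Or.inl ⟨rfl, rfl⟩⟩
      cases i <;> simp
      linarith
    · simp at hl
  | succ n ih =>
    have left : ∀ (j : Bool) (l' : List Bool), l' ∈ goldenWords n true j → ∃ a b, a < b ∧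
        Set.Icc a b ⊆ goldenPiece s false ∧ (∀ x ∈ Set.Icc a b, Follows s (false :: l') x) ∧
      (((cubicMap s)^[n + 1] a = (bif j then 0 else -s) ∧
          (cubicMap s)^[n + 1] b = bif j then 1 else 0) ∨
       ((cubicMap s)^[n + 1] b = (bif j then 0 else -s) ∧
          (cubicMap s)^[n + 1] a = bif j then 1 else 0)) := by
      intro j l' hl'
      obtain ⟨a, b, hab, hJ, hF, hE⟩ := ih true j l' hl'
      obtain ⟨c, d, hcd, hJ', hc, hd, hm⟩ := hs.exists_pullback_left hab hJ
      refine ⟨c, d, hcd, hJ', fun x hx => ⟨hJ' hx, hF _ (hm hx)⟩, ?_⟩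
      rw [Function.iterate_succ_apply, Function.iterate_succ_apply, hc, hd]
      exact hE
    have right : ∀ (k j : Bool) (l' : List Bool), l' ∈ goldenWords n k j → ∃ a b, a < b ∧
        Set.Icc a b ⊆ goldenPiece s true ∧ (∀ x ∈ Set.Icc a b, Follows s (true :: l') x) ∧
      (((cubicMap s)^[n + 1] a = (bif j then 0 else -s) ∧
          (cubicMap s)^[n + 1] b = bif j then 1 else 0) ∨
       ((cubicMap s)^[n + 1] b = (bif j then 0 else -s) ∧
          (cubicMap s)^[n + 1] a = bif j then 1 else 0)) := by
      intro k j l' hl'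
      obtain ⟨a, b, hab, hJ, hF, hE⟩ := ih k j l' hl'
      obtain ⟨c, d, hcd, hJ', hc, hd, hm⟩ :=
        hs.exists_pullback_right hab (hJ.trans (hs.goldenPiece_subset k))
      refine ⟨c, d, hcd, hJ', fun x hx => ⟨hJ' hx, hF _ (hm hx)⟩, ?_⟩
      rw [Function.iterate_succ_apply, Function.iterate_succ_apply, hc, hd]
      exact hE.symm
    intro i j l hl
    cases i
    · simp only [goldenWords, Finset.mem_image] at hl
      obtain ⟨l', hl', rfl⟩ := hl
      exact left j l' hl'
    · simp only [goldenWords, Finset.mem_union, Finset.mem_image] at hl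
      rcases hl with ⟨l', hl', rfl⟩ | ⟨l', hl', rfl⟩
      · exact right _ j l' hl'
      · exact right _ j l' hl'

theorem signWord_eq_of_follows (n : ℕ) : ∀ (i j : Bool) (l : List Bool) (x : ℝ),
    l ∈ goldenWords n i j → Follows s l x → (∀ k, (cubicMap s)^[k] x ≠ 0) →
    signWord s n x = l := by
  have sign : ∀ (i : Bool) (x : ℝ), x ∈ goldenPiece s i → x ≠ 0 → decide (0 < x) = i := by
    intro i x hx h0
    cases i
    · simpa using hx.2
    · simpa using lt_of_le_of_ne hx.1 h0.symm
  induction n with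
  | zero =>
    intro i j l x hl hx h0
    simp only [goldenWords] at hl
    split_ifs at hl with hij
    · rw [Finset.mem_singleton] at hl
      subst hl
      rw [signWord, sign i x hx.1 (h0 0)]
    · simp at hl
  | succ n ih =>
    intro i j l x hl hx h0
    have tail : ∀ k l', l' ∈ goldenWords n k j → Follows s l' (cubicMap s x) →
        signWord s n (cubicMap s x) = l' := fun k l' hl' hx' =>
      ih k j l' _ hl' hx' fun m => h0 (m + 1)
    cases i
    · simp only [goldenWords, Finset.mem_image] at hl
      obtain ⟨l', hl', rfl⟩ := hl
      rw [signWord, sign _ x hx.1 (h0 0), tail _ l' hl' hx.2]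
    · simp only [goldenWords, Finset.mem_union, Finset.mem_image] at hl
      rcases hl with ⟨l', hl', rfl⟩ | ⟨l', hl', rfl⟩ <;>
        rw [signWord, sign _ x hx.1 (h0 0), tail _ l' hl' hx.2]

theorem signWord_mem (hs : GoodParam s) (n : ℕ) : ∀ x : ℝ,
    (∀ k, (cubicMap s)^[k] x ∈ Set.Ioo (-s) 1) → (∀ k, (cubicMap s)^[k] x ≠ 0) →
    signWord s n x ∈ goldenWords n (decide (0 < x)) (decide (0 < (cubicMap s)^[n] x)) := by
  induction n with
  | zero => intro x _ _; rw [goldenWords, signWord, if_pos (by rfl)]; simp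
  | succ n ih =>
    intro x hx h0
    have := ih (cubicMap s x) (fun k => hx (k + 1)) (fun k => h0 (k + 1))
    rw [Function.iterate_succ_apply, signWord]
    by_cases hp : 0 < x
    · rw [decide_eq_true hp]
      simp only [goldenWords, Finset.mem_union, Finset.mem_image]
      cases hq : decide (0 < cubicMap s x)
      · left; rw [hq] at this; exact ⟨_, this, rfl⟩
      · right; rw [hq] at this; exact ⟨_, this, rfl⟩
    · rw [decide_eq_false hp]
      have h2 : 0 < cubicMap s x := lt_of_le_of_ne
        (hs.mapsTo_left ⟨(hx 0).1.le, not_lt.1 hp⟩).1 (h0 1).symm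
      rw [decide_eq_true h2] at this
      exact Finset.mem_image_of_mem _ this

/-- Iterated expansion along a common itinerary. Strictness needs at least one step, hence the
alternative n = 0. -/
theorem hypCoord_le_iterate (hs : GoodParam s) (n : ℕ) : ∀ x y : ℝ,
    (∀ k, (cubicMap s)^[k] x ∈ Set.Ioo (-s) 1) → (∀ k, (cubicMap s)^[k] x ≠ 0) →
    (∀ k, (cubicMap s)^[k] y ∈ Set.Ioo (-s) 1) → (∀ k, (cubicMap s)^[k] y ≠ 0) →
    signWord s n x = signWord s n y → x ≠ y → n = 0 ∨
    |hypCoord s x - hypCoord s y| <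
      |hypCoord s ((cubicMap s)^[n] x) - hypCoord s ((cubicMap s)^[n] y)| := by
  have head : ∀ n x y, signWord s n x = signWord s n y → (0 < x ↔ 0 < y) := by
    intro n x y h
    cases n <;> · simp only [signWord, List.cons.injEq] at h; simpa using h.1
  induction n with
  | zero => intros; left; rfl
  | succ n ih =>
    intro x y hx hx0 hy hy0 hw hne
    right
    have hw' : signWord s n (cubicMap s x) = signWord s n (cubicMap s y) := by
      simp only [signWord, List.cons.injEq] at hw; exact hw.2
    have step := hs.hypCoord_expand hne (hx 0) (hy 0) (hx 1) (hy 1) (hx0 0) (hy0 0) (hx0 1) (hy0 1)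
      (head _ _ _ hw) (head _ _ _ hw')
    have hne' : cubicMap s x ≠ cubicMap s y := by
      intro h; rw [h, sub_self, abs_zero] at step
      exact absurd step (not_lt.2 (abs_nonneg _))
    rw [Function.iterate_succ_apply, Function.iterate_succ_apply]
    rcases ih _ _ (fun k => hx (k + 1)) (fun k => hx0 (k + 1)) (fun k => hy (k + 1))
      (fun k => hy0 (k + 1)) hw' hne' with h | h
    · subst h; exact step
    · exact step.trans h

/-! ### Periodic points in `(-s, 1)` off the critical cycle -/

/-- The fixed points of `F_s^n` in `(-s, 0) ∪ (0, 1)`. -/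
def _root_.innerFixed (s : ℝ) (n : ℕ) : Set ℝ :=
  {x | (cubicMap s)^[n] x = x ∧ x ∈ Set.Ioo (-s) 1 ∧ x ≠ 0}

theorem not_mem_critCycle {x : ℝ} (hx : x ∈ Set.Ioo (-s) 1) (h0 : x ≠ 0) :
    x ∉ ({0, 1, -s} : Set ℝ) := by
  rintro (rfl | rfl | rfl)
  · exact h0 rfl
  · exact lt_irrefl _ hx.2
  · exact lt_irrefl _ hx.1

/-- A periodic orbit that enters a forward invariant set returns to its starting point without
leaving it. -/
theorem iterate_not_mem_of_fixed {f : ℝ → ℝ} {S : Set ℝ} (hS : Set.MapsTo f S S) {n : ℕ}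
    (hn : n ≠ 0) {x : ℝ} (hx : f^[n] x = x) (hxS : x ∉ S) (k : ℕ) : f^[k] x ∉ S := by
  intro hk
  apply hxS
  have h1 : f^[n * k] x = x := by
    rw [Function.iterate_mul]; exact Function.iterate_fixed hx k
  have h2 : n * k = (n * k - k) + k := by
    have : k ≤ n * k := Nat.le_mul_of_pos_left k (Nat.pos_of_ne_zero hn)
    omega
  rw [← h1, h2, Function.iterate_add_apply]
  exact hS.iterate _ hk

theorem iterate_innerFixed (hs : GoodParam s) {n : ℕ} (hn : n ≠ 0) {x : ℝ}
    (hx : x ∈ innerFixed s n) :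
    (∀ k, (cubicMap s)^[k] x ∈ Set.Ioo (-s) 1) ∧ (∀ k, (cubicMap s)^[k] x ≠ 0) := by
  obtain ⟨hfix, hI, h0⟩ := hx
  have hZ := iterate_not_mem_of_fixed hs.mapsTo_critCycle hn hfix (not_mem_critCycle hI h0)
  have hIcc : ∀ k, (cubicMap s)^[k] x ∈ Set.Icc (-s) 1 := fun k =>
    hs.mapsTo.iterate k (Set.Ioo_subset_Icc_self hI)
  refine ⟨fun k => ⟨lt_of_le_of_ne (hIcc k).1 fun h => hZ k ?_,
    lt_of_le_of_ne (hIcc k).2 fun h => hZ k ?_⟩, fun k h => hZ k ?_⟩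
  · rw [← h]; simp
  · rw [h]; simp
  · rw [h]; simp

/-- A fixed endpoint with derivative 0 attracts, so just inside the interval the graph is strictly
below the diagonal. This separates the wanted fixed point from the critical cycle. -/
theorem exists_between_lt_self {g : ℝ → ℝ} {a b : ℝ} (hab : a < b)
    (h : g a < a ∨ (g a = a ∧ HasDerivAt g 0 a)) : ∃ x, a ≤ x ∧ x < b ∧ g x < x := by
  rcases h with h | ⟨h, hd⟩
  · exact ⟨a, le_rfl, hab, h⟩
  · have := (hasDerivAt_iff_isLittleO.1 hd).def (show (0 : ℝ) < 1 / 2 by norm_num)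
    have h2 : ∀ᶠ x in 𝓝[>] a, x ∈ Set.Ioo a b := Ioo_mem_nhdsGT hab
    obtain ⟨x, hx, hxI⟩ := ((this.filter_mono nhdsWithin_le_nhds).and h2).exists
    refine ⟨x, hxI.1.le, hxI.2, ?_⟩
    have hpos : 0 < x - a := sub_pos.2 hxI.1
    simp only [smul_zero, sub_zero, h, Real.norm_eq_abs, abs_of_pos hpos] at hx
    linarith [(abs_le.1 hx).2]

theorem exists_between_self_lt {g : ℝ → ℝ} {a b : ℝ} (hab : a < b)
    (h : b < g b ∨ (g b = b ∧ HasDerivAt g 0 b)) : ∃ x, a < x ∧ x ≤ b ∧ x < g x := by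
  rcases h with h | ⟨h, hd⟩
  · exact ⟨b, hab, le_rfl, h⟩
  · have := (hasDerivAt_iff_isLittleO.1 hd).def (show (0 : ℝ) < 1 / 2 by norm_num)
    have h2 : ∀ᶠ x in 𝓝[<] b, x ∈ Set.Ioo a b := Ioo_mem_nhdsLT hab
    obtain ⟨x, hx, hxI⟩ := ((this.filter_mono nhdsWithin_le_nhds).and h2).exists
    refine ⟨x, hxI.1, hxI.2.le, ?_⟩
    have hneg : x - b < 0 := sub_neg.2 hxI.2
    simp only [smul_zero, sub_zero, h, Real.norm_eq_abs, abs_of_neg hneg] at hx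
    linarith [(abs_le.1 hx).1]

theorem exists_innerFixed (hs : GoodParam s) {n : ℕ} (hn : n ≠ 0) {i : Bool} {l : List Bool}
    (hl : l ∈ goldenWords n i i) : ∃ x ∈ innerFixed s n, signWord s n x = l := by
  have h1 := hs.one_le
  obtain ⟨a, b, hab, hJ, hF, hE⟩ := hs.exists_cylinder n i i l hl
  have hcont : Continuous (cubicMap s)^[n] := (continuous_cubicMap s).iterate n
  have hlo : (bif i then (0 : ℝ) else -s) ∈ ({0, 1, -s} : Set ℝ) := by cases i <;> simp
  have hhi : (bif i then (1 : ℝ) else 0) ∈ ({0, 1, -s} : Set ℝ) := by cases i <;> simp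
  have ha := (hJ (Set.left_mem_Icc.2 hab.le)).1
  have hb := (hJ (Set.right_mem_Icc.2 hab.le)).2
  have hx : ∃ x ∈ Set.Ioo a b, (cubicMap s)^[n] x = x := by
    -- If the orientation is preserved, an end of the cylinder may itself lie on the critical cycle,
    -- and the zero derivative there is needed to get an interior crossing. If it is reversed, the
    -- crossing is strict at both ends.
    rcases hE with ⟨ea, eb⟩ | ⟨eb, ea⟩
    · have pa : (cubicMap s)^[n] a < a ∨
          ((cubicMap s)^[n] a = a ∧ HasDerivAt (cubicMap s)^[n] 0 a) := by
        rcases ha.eq_or_lt with h | h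
        · right
          refine ⟨ea.trans h, hs.hasDerivAt_iterate_critCycle (h ▸ hlo) hn (ea.trans h)⟩
        · left; rw [ea]; exact h
      have pb : b < (cubicMap s)^[n] b ∨
          ((cubicMap s)^[n] b = b ∧ HasDerivAt (cubicMap s)^[n] 0 b) := by
        rcases hb.eq_or_lt with h | h
        · right
          refine ⟨eb.trans h.symm, hs.hasDerivAt_iterate_critCycle (h ▸ hhi) hn (eb.trans h.symm)⟩
        · left; rw [eb]; exact h
      obtain ⟨x, hx1, hx2, hx3⟩ := exists_between_lt_self (show a < (a + b) / 2 by linarith) pa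
      obtain ⟨y, hy1, hy2, hy3⟩ := exists_between_self_lt (show (a + b) / 2 < b by linarith) pb
      obtain ⟨z, hz, hz0⟩ := intermediate_value_Ioo (show x ≤ y by linarith)
        (f := fun t => (cubicMap s)^[n] t - t) (by fun_prop)
        (show (0 : ℝ) ∈ _ from ⟨by linarith, by linarith⟩)
      exact ⟨z, ⟨by linarith [hz.1], by linarith [hz.2]⟩, by simpa [sub_eq_zero] using hz0⟩
    · obtain ⟨z, hz, hz0⟩ := intermediate_value_Ioo' hab.le
        (f := fun t => (cubicMap s)^[n] t - t) (by fun_prop)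
        (show (0 : ℝ) ∈ _ from ⟨by simp only [eb]; linarith, by simp only [ea]; linarith⟩)
      exact ⟨z, hz, by simpa [sub_eq_zero] using hz0⟩
  obtain ⟨x, hxI, hfix⟩ := hx
  have hx : x ∈ innerFixed s n := by
    refine ⟨hfix, ?_, ?_⟩
    · have := hs.goldenPiece_subset i (hJ (Set.left_mem_Icc.2 hab.le))
      have := hs.goldenPiece_subset i (hJ (Set.right_mem_Icc.2 hab.le))
      constructor <;> simp_all <;> linarith
    · rintro rfl
      cases i
      · exact absurd (hxI.2.trans_le hb) (lt_irrefl _)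
      · exact absurd (ha.trans_lt hxI.1) (lt_irrefl _)
  exact ⟨x, hx, signWord_eq_of_follows n i i l x hl (hF x (Set.Ioo_subset_Icc_self hxI))
    (hs.iterate_innerFixed hn hx).2⟩

theorem injOn_signWord (hs : GoodParam s) {n : ℕ} (hn : n ≠ 0) :
    Set.InjOn (signWord s n) (innerFixed s n) := by
  intro x hx y hy hw
  by_contra hne
  obtain ⟨hx1, hx2⟩ := hs.iterate_innerFixed hn hx
  obtain ⟨hy1, hy2⟩ := hs.iterate_innerFixed hn hy
  rcases hs.hypCoord_le_iterate n x y hx1 hx2 hy1 hy2 hw hne with h | h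
  · exact hn h
  · rw [hx.1, hy.1] at h
    exact lt_irrefl _ h

theorem image_signWord (hs : GoodParam s) {n : ℕ} (hn : n ≠ 0) :
    signWord s n '' innerFixed s n =
      (goldenWords n false false ∪ goldenWords n true true : Finset (List Bool)) := by
  ext l
  constructor
  · rintro ⟨x, hx, rfl⟩
    obtain ⟨hx1, hx2⟩ := hs.iterate_innerFixed hn hx
    have := hs.signWord_mem n x hx1 hx2
    rw [hx.1] at this
    rw [Finset.mem_coe, Finset.mem_union]
    cases h : decide (0 < x)
    · left; rwa [h] at this
    · right; rwa [h] at this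
  · intro hl
    rw [Finset.mem_coe, Finset.mem_union] at hl
    rcases hl with hl | hl <;> exact hs.exists_innerFixed hn hl

theorem finite_innerFixed (hs : GoodParam s) {n : ℕ} (hn : n ≠ 0) : (innerFixed s n).Finite := by
  apply Set.Finite.of_finite_image _ (hs.injOn_signWord hn)
  rw [hs.image_signWord hn]
  exact Finset.finite_toSet _

theorem ncard_innerFixed (hs : GoodParam s) (m : ℕ) :
    (innerFixed s (m + 1)).ncard = Nat.fib (m + 2) + Nat.fib m := by
  rw [← (hs.injOn_signWord m.succ_ne_zero).ncard_image,
    hs.image_signWord m.succ_ne_zero, Set.ncard_coe_finset, card_cyclic_goldenWords]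

/-! ### Periodic points outside `[-s, 1]` -/

theorem map_lt_of_one_lt (hs : GoodParam s) {x : ℝ} (hx : 1 < x) : cubicMap s x < -s := by
  obtain ⟨u, hu0, hu1, hu, ha, hb, hu2⟩ := hs.exists_u
  have h1 := hs.one_le
  have e : cubicMap s x + s = -((x - 1) * ((1 - u) * x ^ 2 + (1 + s) * x + (1 + s))) := by
    rw [cubicMap_apply, ha, hb]; ring
  have : 0 < (x - 1) * ((1 - u) * x ^ 2 + (1 + s) * x + (1 + s)) := by
    have : 0 < x - 1 := by linarith
    have : 0 < 1 - u := by linarith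
    positivity
  linarith

theorem abs_sub_lt_of_one_lt (hs : GoodParam s) {x y : ℝ} (hx : 1 < x) (hy : 1 < y)
    (hne : x ≠ y) : |x - y| < |cubicMap s x - cubicMap s y| := by
  obtain ⟨u, hu0, hu1, hu, ha, hb, hu2⟩ := hs.exists_u
  have h1 := hs.one_le
  have e : cubicMap s x - cubicMap s y =
      (x - y) * -((1 - u) * (x ^ 2 + x * y + y ^ 2) + (s + u) * (x + y)) := by
    rw [cubicMap_apply, cubicMap_apply, ha, hb]; ring
  rw [e, abs_mul, abs_neg]
  apply lt_mul_of_one_lt_right (abs_pos.2 (sub_ne_zero.2 hne))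
  apply lt_of_lt_of_le _ (le_abs_self _)
  have : 0 < (1 - u) * (x ^ 2 + x * y + y ^ 2) := by
    have : 0 < 1 - u := by linarith
    positivity
  nlinarith

/-- F(z) > 1 forces az + b > 0, which makes all terms of the chord slope have one sign; the mixed
term alone exceeds 1 in size. -/
theorem abs_sub_lt_of_lt_neg (hs : GoodParam s) {x y : ℝ} (hx : x < -s) (hy : y < -s)
    (hfx : 1 < cubicMap s x) (hfy : 1 < cubicMap s y) (hne : x ≠ y) :
    |x - y| < |cubicMap s x - cubicMap s y| := by
  obtain ⟨u, hu0, hu1, hu, ha, hb, hu2⟩ := hs.exists_u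
  have h1 := hs.one_le
  have e : cubicMap s x - cubicMap s y =
      (x - y) * -(-x * ((1 - u) * -x - (s + u)) + -y * ((1 - u) * -y - (s + u))
        + (1 - u) * (x * y)) := by
    rw [cubicMap_apply, cubicMap_apply, ha, hb]; ring
  have key : ∀ z, z < -s → 1 < cubicMap s z → 0 < (1 - u) * -z - (s + u) := by
    intro z hz hfz
    rw [cubicMap_apply, ha, hb] at hfz
    have : 0 < z ^ 2 * ((1 - u) * -z - (s + u)) := by linarith
    exact (pos_iff_pos_of_mul_pos this).1 (by nlinarith)
  have kx := key x hx hfx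
  have ky := key y hy hfy
  rw [e, abs_mul, abs_neg]
  apply lt_mul_of_one_lt_right (abs_pos.2 (sub_ne_zero.2 hne))
  apply lt_of_lt_of_le _ (le_abs_self _)
  have j1 : 0 < -x * ((1 - u) * -x - (s + u)) := mul_pos (by linarith) kx
  have j2 : 0 < -y * ((1 - u) * -y - (s + u)) := mul_pos (by linarith) ky
  have j3 : 1 < (1 - u) * (x * y) := by nlinarith
  linarith

theorem exists_outer_cycle (hs : GoodParam s) :
    ∃ p, 1 < p ∧ cubicMap s (cubicMap s p) = p := by
  obtain ⟨u, hu0, hu1, hu, ha, hb, hu2⟩ := hs.exists_u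
  have h1 := hs.one_le
  have h2 := hs.le_three_halves
  have h10 : cubicMap s 10 ≤ -500 := by rw [cubicMap_apply, ha, hb]; linarith
  have hbig : 10 < cubicMap s (cubicMap s 10) := by
    generalize cubicMap s 10 = y at h10
    rw [cubicMap_apply, ha, hb]
    have : 248 ≤ (1 - u) * -y - (s + u) := by nlinarith
    nlinarith [sq_nonneg y]
  -- F² takes 1 to 0, below the diagonal, and takes 10 above it.
  obtain ⟨z, hz, hz0⟩ := intermediate_value_Ioo (show (1 : ℝ) ≤ 10 by norm_num)
    (f := fun t => cubicMap s (cubicMap s t) - t)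
    (by have := continuous_cubicMap s; fun_prop)
    (show (0 : ℝ) ∈ _ from ⟨by simp [hs.map_one, hs.map_neg], by linarith⟩)
  exact ⟨z, hz.1, by simpa [sub_eq_zero] using hz0⟩

/-- A periodic orbit outside [-s, 1] must alternate between (1, ∞) and (-∞, -s). On both sides F
increases distances, so the distance to p grows strictly under F² and cannot return to its initial
value. -/
theorem eq_of_fixed_of_one_lt (hs : GoodParam s) {p : ℝ} (hp : 1 < p)
    (hpp : cubicMap s (cubicMap s p) = p) {n : ℕ} (hn : n ≠ 0) {x : ℝ} (hx : 1 < x)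
    (hfix : (cubicMap s)^[n] x = x) : 2 ∣ n ∧ x = p := by
  have h1 := hs.one_le
  have hout := iterate_not_mem_of_fixed hs.mapsTo hn hfix
    (fun h => absurd h.2 (not_le.2 hx))
  have key : ∀ k, 1 < (cubicMap s)^[2 * k] x := by
    intro k
    induction k with
    | zero => exact hx
    | succ k ih =>
      have e : 2 * (k + 1) = (2 * k).succ.succ := by omega
      have ho := hout (2 * (k + 1))
      rw [e, Function.iterate_succ_apply', Function.iterate_succ_apply'] at ho ⊢
      have hlt := hs.map_lt_of_one_lt ih
      by_contra! hle
      exact ho ⟨hs.neg_le_map (by linarith), hle⟩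
  have hdvd : 2 ∣ n := by
    by_contra hodd
    obtain ⟨k, hk⟩ : ∃ k, n = (2 * k).succ := ⟨n / 2, by omega⟩
    rw [hk, Function.iterate_succ_apply'] at hfix
    have := hs.map_lt_of_one_lt (key k)
    linarith
  refine ⟨hdvd, ?_⟩
  by_contra hne
  have step : ∀ k, (cubicMap s)^[2 * k] x ≠ p →
      |(cubicMap s)^[2 * k] x - p| < |(cubicMap s)^[2 * (k + 1)] x - p| := by
    intro k hk
    have e : 2 * (k + 1) = (2 * k).succ.succ := by omega
    have hk1 := key (k + 1)
    rw [e, Function.iterate_succ_apply', Function.iterate_succ_apply'] at hk1 ⊢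
    have i1 := hs.abs_sub_lt_of_one_lt (key k) hp hk
    refine i1.trans ?_
    have i2 := hs.abs_sub_lt_of_lt_neg (hs.map_lt_of_one_lt (key k)) (hs.map_lt_of_one_lt hp) hk1
      (by rw [hpp]; exact hp) (by
        intro h; rw [h, sub_self, abs_zero] at i1
        exact absurd i1 (not_lt.2 (abs_nonneg _)))
    rwa [hpp] at i2
  have grow : ∀ k, |x - p| < |(cubicMap s)^[2 * (k + 1)] x - p| := by
    intro k
    induction k with
    | zero => exact step 0 hne
    | succ k ih =>
      refine ih.trans (step (k + 1) fun h => ?_)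
      rw [h, sub_self, abs_zero] at ih
      exact absurd ih (not_lt.2 (abs_nonneg _))
  obtain ⟨m, rfl⟩ := hdvd
  obtain ⟨k, rfl⟩ := Nat.exists_eq_succ_of_ne_zero (show m ≠ 0 by rintro rfl; exact hn rfl)
  have := grow k
  rw [hfix] at this
  exact lt_irrefl _ this

theorem fixed_outside_iff (hs : GoodParam s) {p : ℝ} (hp : 1 < p)
    (hpp : cubicMap s (cubicMap s p) = p) {n : ℕ} (hn : n ≠ 0) (x : ℝ) :
    (cubicMap s)^[n] x = x ∧ x ∉ Set.Icc (-s) 1 ↔ 2 ∣ n ∧ (x = p ∨ x = cubicMap s p) := by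
  have h1 := hs.one_le
  have hq := hs.map_lt_of_one_lt hp
  have hper : ∀ m, (cubicMap s)^[2 * m] p = p := fun m => by
    rw [Function.iterate_mul]; exact Function.iterate_fixed (f := (cubicMap s)^[2]) hpp m
  constructor
  · rintro ⟨hfix, hx⟩
    rcases lt_or_ge 1 x with h | h
    · have := hs.eq_of_fixed_of_one_lt hp hpp hn h hfix
      exact ⟨this.1, Or.inl this.2⟩
    · have hxs : x < -s := by
        by_contra! h'; exact hx ⟨h', h⟩
      have ho := iterate_not_mem_of_fixed hs.mapsTo hn hfix hx 1
      have hfx : 1 < cubicMap s x := by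
        by_contra! h'
        exact ho ⟨hs.neg_le_map (by linarith), h'⟩
      have hfix' : (cubicMap s)^[n] (cubicMap s x) = cubicMap s x := by
        rw [← Function.iterate_succ_apply, Function.iterate_succ_apply', hfix]
      obtain ⟨hd, he⟩ := hs.eq_of_fixed_of_one_lt hp hpp hn hfx hfix'
      refine ⟨hd, Or.inr ?_⟩
      obtain ⟨k, hk⟩ : ∃ k, n = (2 * k).succ.succ := ⟨n / 2 - 1, by omega⟩
      rw [hk, Function.iterate_succ_apply, he, Function.iterate_succ_apply', hper] at hfix
      exact hfix.symm
  · rintro ⟨⟨m, rfl⟩, rfl | rfl⟩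
    · exact ⟨hper m, fun h => absurd h.2 (not_le.2 hp)⟩
    · refine ⟨?_, fun h => absurd h.1 (not_le.2 hq)⟩
      rw [← Function.iterate_succ_apply, Function.iterate_succ_apply', hper]

/-! ### Counting all periodic points -/

theorem fixed_eq (hs : GoodParam s) {p : ℝ} (hp : 1 < p)
    (hpp : cubicMap s (cubicMap s p) = p) {n : ℕ} (hn : n ≠ 0) :
    {x : ℝ | (cubicMap s)^[n] x = x} =
      (if 3 ∣ n then {0, 1, -s} else ∅) ∪ (if 2 ∣ n then {p, cubicMap s p} else ∅) ∪
        innerFixed s n := by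
  have h1 := hs.one_le
  have hout := hs.fixed_outside_iff hp hpp hn
  ext x
  simp only [Set.mem_ofPred_eq, Set.mem_union]
  have hA : x ∈ (if 3 ∣ n then {0, 1, -s} else ∅ : Set ℝ) ↔ 3 ∣ n ∧ x ∈ ({0, 1, -s} : Set ℝ) := by
    split_ifs with h <;> simp [h]
  have hB : x ∈ (if 2 ∣ n then {p, cubicMap s p} else ∅ : Set ℝ) ↔
      2 ∣ n ∧ (x = p ∨ x = cubicMap s p) := by
    split_ifs with h <;> simp [h]
  rw [hA, hB, ← hout]
  constructor
  · intro hfix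
    by_cases hI : x ∈ Set.Icc (-s) 1
    · by_cases hZ : x ∈ ({0, 1, -s} : Set ℝ)
      · exact Or.inl (Or.inl ⟨(hs.iterate_critCycle_iff hZ n).1 hfix, hZ⟩)
      · right
        refine ⟨hfix, ⟨lt_of_le_of_ne hI.1 fun h => hZ ?_, lt_of_le_of_ne hI.2 fun h => hZ ?_⟩,
          fun h => hZ ?_⟩
        · rw [← h]; simp
        · rw [h]; simp
        · rw [h]; simp
    · exact Or.inl (Or.inr ⟨hfix, hI⟩)
  · rintro ((⟨h3, hZ⟩ | h) | h)
    · exact (hs.iterate_critCycle_iff hZ n).2 h3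
    · exact h.1
    · exact h.1

theorem finite_fixed (hs : GoodParam s) {n : ℕ} (hn : n ≠ 0) :
    {x : ℝ | (cubicMap s)^[n] x = x}.Finite := by
  obtain ⟨p, hp, hpp⟩ := hs.exists_outer_cycle
  rw [hs.fixed_eq hp hpp hn]
  refine (Set.Finite.union ?_ ?_).union (hs.finite_innerFixed hn) <;> split_ifs <;> simp

theorem _root_.numIsolatedFixedPts_eq_ncard {f : ℝ → ℝ} {n : ℕ}
    (h : {x : ℝ | f^[n] x = x}.Finite) :
    numIsolatedFixedPts f n = {x : ℝ | f^[n] x = x}.ncard := by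
  rw [numIsolatedFixedPts]
  congr 1
  ext x
  simp only [Set.mem_ofPred_eq, and_iff_left_iff_imp]
  intro _
  have : ({x : ℝ | f^[n] x = x} \ {x})ᶜ ∈ 𝓝 x :=
    h.sdiff.isClosed.isOpen_compl.mem_nhds (by simp)
  filter_upwards [nhdsWithin_le_nhds this, self_mem_nhdsWithin] with y hy hne hfix
  exact hy ⟨hfix, hne⟩

theorem numIsolatedFixedPts_cubicMap (hs : GoodParam s) (m : ℕ) :
    numIsolatedFixedPts (cubicMap s) (m + 1) =
      (if 3 ∣ m + 1 then 3 else 0) + (if 2 ∣ m + 1 then 2 else 0) +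
        (Nat.fib (m + 2) + Nat.fib m) := by
  have h1 := hs.one_le
  have hn := m.succ_ne_zero
  obtain ⟨p, hp, hpp⟩ := hs.exists_outer_cycle
  have hq := hs.map_lt_of_one_lt hp
  rw [numIsolatedFixedPts_eq_ncard (hs.finite_fixed hn), hs.fixed_eq hp hpp hn]
  have fA : (if 3 ∣ m + 1 then {0, 1, -s} else ∅ : Set ℝ).Finite := by split_ifs <;> simp
  have fB : (if 2 ∣ m + 1 then {p, cubicMap s p} else ∅ : Set ℝ).Finite := by split_ifs <;> simp
  have subA : (if 3 ∣ m + 1 then {0, 1, -s} else ∅ : Set ℝ) ⊆ {0, 1, -s} := by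
    split_ifs <;> simp
  have subB : (if 2 ∣ m + 1 then {p, cubicMap s p} else ∅ : Set ℝ) ⊆ (Set.Icc (-s) 1)ᶜ := by
    split_ifs
    · rintro x (rfl | rfl)
      · exact fun h => absurd h.2 (not_le.2 hp)
      · exact fun h => absurd h.1 (not_le.2 hq)
    · simp
  have subZ : ({0, 1, -s} : Set ℝ) ⊆ Set.Icc (-s) 1 := by
    rintro x (rfl | rfl | rfl) <;> constructor <;> linarith
  rw [Set.ncard_union_eq _ (fA.union fB) (hs.finite_innerFixed hn), Set.ncard_union_eq _ fA fB,
    hs.ncard_innerFixed]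
  · congr 2
    · split_ifs
      · rw [Set.ncard_eq_three]
        exact ⟨0, 1, -s, by norm_num, by intro h; linarith, by intro h; linarith, rfl⟩
      · simp
    · split_ifs
      · exact Set.ncard_pair (by intro h; linarith)
      · simp
  · exact Set.disjoint_left.2 fun x hA hB => subB hB (subZ (subA hA))
  · refine Set.disjoint_left.2 fun x hx hP => ?_
    rcases hx with hA | hB
    · exact not_mem_critCycle hP.2.1 hP.2.2 (subA hA)
    · exact subB hB (Set.Ioo_subset_Icc_self hP.2.1)

end GoodParam


/-! ### The orbit of the second critical point as a function of the parameter -/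

theorem exists_goodParam_endpoint : ∃ t : ℝ, 1 < t ∧ t ^ 3 * (t + 1) = 2 + 3 * t ∧
    ∀ s ∈ Set.Icc 1 t, GoodParam s := by
  obtain ⟨t, ht, h0⟩ := intermediate_value_Ioo (show (1 : ℝ) ≤ 3 / 2 by norm_num)
    (f := fun t => t ^ 3 * (t + 1) - (2 + 3 * t)) (by fun_prop)
    (show (0 : ℝ) ∈ _ from ⟨by norm_num, by norm_num⟩)
  have h0' : t ^ 3 * (t + 1) = 2 + 3 * t := by simpa [sub_eq_zero] using h0
  refine ⟨t, ht.1, h0', fun s hs => ⟨hs.1, ?_⟩⟩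
  have h1 := hs.1
  have h2 : s ≤ t := hs.2
  have i1 : 1 ≤ s ^ 3 := one_le_pow₀ h1
  -- These bounds express that s³ (s + 1) - 3s increases on [1, t], so the inequality at t passes to
  -- all smaller s.
  have i2 : 3 * (t - s) ≤ t ^ 3 - s ^ 3 := by
    have : 0 ≤ (t - s) * (t ^ 2 + t * s + s ^ 2 - 3) :=
      mul_nonneg (by linarith) (by nlinarith)
    linarith
  have i3 : 0 ≤ (t ^ 3 - 1) * (t - s) := mul_nonneg (by linarith) (by linarith)
  have i4 : 0 ≤ (t ^ 3 - s ^ 3) * (s - 1) := mul_nonneg (by linarith) (by linarith)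
  linarith

/-- The orbit of the critical point `cubicCrit s`. -/
noncomputable def postCrit (s : ℝ) (n : ℕ) : ℝ := (cubicMap s)^[n] (cubicCrit s)

theorem postCrit_succ (s : ℝ) (n : ℕ) : postCrit s (n + 1) = cubicMap s (postCrit s n) :=
  Function.iterate_succ_apply' _ _ _

theorem postCrit_add (s : ℝ) (m n : ℕ) :
    postCrit s (m + n) = (cubicMap s)^[m] (postCrit s n) :=
  Function.iterate_add_apply _ _ _ _

theorem continuousOn_postCrit {t : ℝ} (ht : ∀ s ∈ Set.Icc 1 t, GoodParam s) (n : ℕ) :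
    ContinuousOn (fun s => postCrit s n) (Set.Icc 1 t) := by
  have hd : ∀ s ∈ Set.Icc 1 t, s ^ 2 * (s + 1) ≠ 0 := fun s hs => by
    have := hs.1; positivity
  have hA : ContinuousOn cubicA (Set.Icc 1 t) := by
    unfold cubicA
    exact continuousOn_const.add (continuousOn_const.div (by fun_prop) hd)
  have hB : ContinuousOn cubicB (Set.Icc 1 t) := by
    unfold cubicB
    exact (continuousOn_id.neg).sub (continuousOn_const.div (by fun_prop) hd)
  induction n with
  | zero =>
    change ContinuousOn (fun s => -2 * cubicB s / (3 * cubicA s)) _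
    refine (continuousOn_const.mul hB).div (continuousOn_const.mul hA) fun s hs => ?_
    have := (ht s hs).cubicA_neg.ne
    positivity
  | succ n ih =>
    simp only [postCrit_succ, cubicMap_apply]
    fun_prop

namespace GoodParam
variable {s : ℝ}

theorem postCrit_one_mem (hs : GoodParam s) : postCrit s 1 ∈ Set.Icc (-s) 0 :=
  ⟨hs.neg_le_map_crit, hs.map_crit_nonpos⟩

theorem postCrit_two_mem (hs : GoodParam s) : postCrit s 2 ∈ Set.Icc (0 : ℝ) 1 :=
  hs.mapsTo_left hs.postCrit_one_mem

theorem postCrit_mem (hs : GoodParam s) (n : ℕ) : postCrit s (n + 1) ∈ Set.Icc (-s) 1 := by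
  rw [postCrit_add]
  exact hs.mapsTo.iterate n (hs.goldenPiece_subset false hs.postCrit_one_mem)

end GoodParam

theorem postCrit_one_two : postCrit 1 2 = 0 := by
  have hs : GoodParam 1 := ⟨le_rfl, by norm_num⟩
  have : postCrit 1 1 = -1 := by
    change cubicMap 1 (cubicCrit 1) = -1
    rw [cubicMap_apply, cubicCrit, cubicA, cubicB]; norm_num
  rw [postCrit_succ, this, hs.map_neg]

theorem postCrit_endpoint_two {t : ℝ} (hs : GoodParam t) (ht : t ^ 3 * (t + 1) = 2 + 3 * t) :
    postCrit t 2 = 1 := by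
  obtain ⟨u, -, -, hu, ha, hb, -⟩ := hs.exists_u
  have hc : cubicCrit t = -t := by
    have h := hs.cubicA_mul_crit
    have ha0 := hs.cubicA_neg.ne
    have : 3 * cubicA t * (cubicCrit t + t) = 0 := by
      rw [mul_add, h, ha, hb]
      linear_combination t * hu - u * ht
    have := (mul_eq_zero.1 this).resolve_left (by positivity)
    linarith
  have : postCrit t 1 = 0 := by
    change cubicMap t (cubicCrit t) = 0
    rw [hc, hs.map_neg]
  rw [postCrit_succ, this, GoodParam.map_zero]

/-! ### Realising itineraries by parameters -/

/-- A continuous function with values of opposite signs at `a` and `b` has a zero after which it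
keeps its sign up to `b`. -/
theorem exists_last_zero {g : ℝ → ℝ} {a b : ℝ} (hg : ContinuousOn g (Set.uIcc a b))
    (ha : g a ≤ 0) (hb : 0 ≤ g b) :
    ∃ c ∈ Set.uIcc a b, g c = 0 ∧ ∀ x ∈ Set.uIcc c b, 0 ≤ g x := by
  wlog hab : a ≤ b generalizing g a b
  · have hab' : -a ≤ -b := by linarith [not_le.1 hab]
    have hmem : ∀ p q x : ℝ, x ∈ Set.uIcc (-p) (-q) ↔ -x ∈ Set.uIcc p q := by
      intro p q x
      simp only [Set.mem_uIcc]
      constructor <;> rintro (h | h) <;> [right; left; right; left] <;>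
        constructor <;> linarith [h.1, h.2]
    obtain ⟨c, hc, h0, h⟩ := this (g := fun x => g (-x)) (a := -a) (b := -b)
      (hg.comp continuousOn_neg fun x hx => (hmem a b x).1 hx)
      (by simpa using ha) (by simpa using hb) hab'
    refine ⟨-c, (hmem a b c).1 hc, h0, fun x hx => ?_⟩
    have := h (-x) (by rw [← neg_neg c, hmem]; simpa using hx)
    simpa using this
  · rw [Set.uIcc_of_le hab] at hg ⊢
    have hZc : IsCompact (Set.Icc a b ∩ g ⁻¹' {0}) := isCompact_Icc.of_isClosed_subset
      (hg.preimage_isClosed_of_isClosed isClosed_Icc isClosed_singleton) Set.inter_subset_left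
    have hZn : (Set.Icc a b ∩ g ⁻¹' {0}).Nonempty := by
      obtain ⟨z, hz, hz0⟩ := intermediate_value_Icc hab hg ⟨ha, hb⟩
      exact ⟨z, hz, hz0⟩
    obtain ⟨c, ⟨hc, hc0⟩, hmax⟩ := hZc.exists_isGreatest hZn
    refine ⟨c, hc, hc0, fun x hx => ?_⟩
    rw [Set.uIcc_of_le hc.2] at hx
    by_contra! hneg
    obtain ⟨z, hz, hz0⟩ := intermediate_value_Icc hx.2
      (hg.mono (Set.Icc_subset_Icc (hc.1.trans hx.1) le_rfl)) ⟨hneg.le, hb⟩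
    have h1 := hmax ⟨⟨(hc.1.trans hx.1).trans hz.1, hz.2⟩, hz0⟩
    have h2 : x = c := le_antisymm (hz.1.trans h1) hx.1
    rw [h2] at hneg
    exact hneg.ne hc0

/-- Induction on parameter intervals across which the current orbit point runs from 0 to the other
end of its piece. No monotonicity in s is needed. The intervals are unordered because either end may
be the one with value 0. -/
theorem exists_param_finite {t : ℝ} (h1t : 1 < t) (ht : ∀ s ∈ Set.Icc 1 t, GoodParam s)
    (hend : t ^ 3 * (t + 1) = 2 + 3 * t) {θ : ℕ → Bool} (h0 : θ 0 = true)
    (hadm : ∀ n, θ n = false → θ (n + 1) = true) (n : ℕ) :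
    ∃ a ∈ Set.Icc 1 t, ∃ b ∈ Set.Icc 1 t,
      (∀ s ∈ Set.uIcc a b, ∀ i ≤ n, postCrit s (i + 2) ∈ goldenPiece s (θ i)) ∧
      postCrit a (n + 2) = 0 ∧ postCrit b (n + 2) = bif θ n then 1 else -b := by
  have h11 : (1 : ℝ) ∈ Set.Icc 1 t := ⟨le_rfl, h1t.le⟩
  have htt : t ∈ Set.Icc 1 t := ⟨h1t.le, le_rfl⟩
  induction n with
  | zero =>
    refine ⟨1, h11, t, htt, fun s hs i hi => ?_, postCrit_one_two, ?_⟩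
    · rw [Set.uIcc_of_le h1t.le] at hs
      obtain rfl : i = 0 := by omega
      rw [h0]
      exact (ht s hs).postCrit_two_mem
    · rw [h0]; exact postCrit_endpoint_two (ht t htt) hend
  | succ n ih =>
    obtain ⟨a, ha, b, hb, hJ, ea, eb⟩ := ih
    have hsub : Set.uIcc a b ⊆ Set.Icc 1 t := Set.ordConnected_Icc.uIcc_subset ha hb
    have hcont : ContinuousOn (fun s => postCrit s (n + 1 + 2)) (Set.uIcc a b) :=
      (continuousOn_postCrit ht _).mono hsub
    have ea' : postCrit a (n + 1 + 2) = 1 := by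
      rw [show n + 1 + 2 = n + 2 + 1 by ring, postCrit_succ, ea, GoodParam.map_zero]
    have step : ∀ c ∈ Set.uIcc a b, ∀ d ∈ Set.uIcc a b,
        (∀ s ∈ Set.uIcc c d, postCrit s (n + 1 + 2) ∈ goldenPiece s (θ (n + 1))) →
        ∀ s ∈ Set.uIcc c d, ∀ i ≤ n + 1, postCrit s (i + 2) ∈ goldenPiece s (θ i) := by
      intro c hc d hd hnew s hs i hi
      rcases Nat.lt_or_ge n i with h | h
      · obtain rfl : i = n + 1 := by omega
        exact hnew s hs
      · exact hJ s (Set.ordConnected_uIcc.uIcc_subset hc hd hs) i h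
    -- After the letter `false` the next point already runs between 1 and 0 inside [0, 1], so the
    -- interval is kept with its ends swapped. After `true` it runs from 1 to -b, and the interval
    -- is cut at the last zero before the end selected by the next letter.
    cases hθ : θ n
    · rw [hθ] at eb
      have hθ' := hadm n hθ
      have eb' : postCrit b (n + 1 + 2) = 0 := by
        rw [show n + 1 + 2 = n + 2 + 1 by ring, postCrit_succ, eb]
        exact (ht b hb).map_neg
      refine ⟨b, hb, a, ha, step b Set.right_mem_uIcc a Set.left_mem_uIcc fun s hs => ?_, eb', ?_⟩
      · rw [Set.uIcc_comm] at hs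
        have := hJ s hs n le_rfl
        rw [hθ] at this
        rw [hθ', show n + 1 + 2 = n + 2 + 1 by ring, postCrit_succ]
        exact (ht s (hsub hs)).mapsTo_left this
      · rw [hθ']; exact ea'
    · rw [hθ] at eb
      have eb' : postCrit b (n + 1 + 2) = -b := by
        rw [show n + 1 + 2 = n + 2 + 1 by ring, postCrit_succ, eb]
        exact (ht b hb).map_one
      have hb1 := hb.1
      cases hθ' : θ (n + 1)
      · obtain ⟨c, hc, hc0, hpos⟩ := exists_last_zero (a := a) (b := b) hcont.neg
          (by simp only [Pi.neg_apply, ea']; norm_num)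
          (by simp only [Pi.neg_apply, eb']; linarith)
        refine ⟨c, hsub hc, b, hb, step c hc b Set.right_mem_uIcc fun s hs => ?_,
          by simpa using hc0, eb'⟩
        rw [hθ']
        have := hpos s hs
        exact ⟨((ht s (hsub (Set.ordConnected_uIcc.uIcc_subset hc Set.right_mem_uIcc hs))).postCrit_mem
          (n + 2)).1, by simpa using this⟩
      · rw [Set.uIcc_comm] at hcont
        obtain ⟨c, hc, hc0, hpos⟩ := exists_last_zero (a := b) (b := a) hcont
          (by simp only [eb']; linarith) (by simp only [ea']; norm_num)
        rw [Set.uIcc_comm] at hc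
        refine ⟨c, hsub hc, a, ha, step c hc a Set.left_mem_uIcc fun s hs => ?_,
          hc0, ea'⟩
        rw [hθ']
        exact ⟨hpos s hs, ((ht s (hsub (Set.ordConnected_uIcc.uIcc_subset hc Set.left_mem_uIcc
          hs))).postCrit_mem (n + 2)).2⟩

theorem exists_param {t : ℝ} (h1t : 1 < t) (ht : ∀ s ∈ Set.Icc 1 t, GoodParam s)
    (hend : t ^ 3 * (t + 1) = 2 + 3 * t) {θ : ℕ → Bool} (h0 : θ 0 = true)
    (hadm : ∀ n, θ n = false → θ (n + 1) = true) :
    ∃ s ∈ Set.Icc 1 t, ∀ i, postCrit s (i + 2) ∈ goldenPiece s (θ i) := by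
  have hclosed : ∀ i, IsClosed
      {s | s ∈ Set.Icc 1 t ∧ postCrit s (i + 2) ∈ goldenPiece s (θ i)} := by
    intro i
    have hlo : Continuous fun s : ℝ => (bif θ i then 0 else -s : ℝ) := by
      cases θ i
      · exact continuous_neg
      · exact continuous_const
    have c1 := isClosed_Icc.isClosed_le hlo.continuousOn (continuousOn_postCrit ht (i + 2))
    have c2 := isClosed_Icc.isClosed_le (continuousOn_postCrit ht (i + 2))
      (continuousOn_const (c := (bif θ i then 1 else 0 : ℝ)))
    convert c1.inter c2 using 1
    ext s
    simp only [goldenPiece, Set.mem_Icc, Set.mem_ofPred_eq, Set.mem_inter_iff]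
    tauto
  obtain ⟨s, hs, hsi⟩ := isCompact_Icc.inter_iInter_nonempty _ hclosed (fun v => by
    obtain ⟨a, ha, b, hb, hJ, -⟩ := exists_param_finite h1t ht hend h0 hadm (v.sup id)
    refine ⟨a, ha, ?_⟩
    simp only [Set.mem_iInter]
    exact fun i hi => ⟨ha, hJ a Set.left_mem_uIcc i (Finset.le_sup (f := id) hi)⟩)
  rw [Set.mem_iInter] at hsi
  exact ⟨s, hs, fun i => (hsi i).2⟩

/-! ### Eventually periodic sequences -/

/-- Eventual periodicity of a sequence. -/
def EventuallyPeriodicSeq (θ : ℕ → Bool) : Prop :=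
  ∃ p N, 0 < p ∧ ∀ n, N ≤ n → θ (n + p) = θ n

theorem countable_eventuallyPeriodicSeq : {θ | EventuallyPeriodicSeq θ}.Countable := by
  have hfin : ∀ p N : ℕ, {θ : ℕ → Bool | 0 < p ∧ ∀ n, N ≤ n → θ (n + p) = θ n}.Finite := by
    intro p N
    -- Such a sequence is determined by its first N + p terms.
    apply Set.Finite.of_finite_image (f := fun θ => fun i : Fin (N + p) => θ i) (Set.toFinite _)
    rintro θ ⟨hp, hθ⟩ η ⟨-, hη⟩ h
    funext n
    induction n using Nat.strong_induction_on with
    | _ n ih =>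
      rcases Nat.lt_or_ge n (N + p) with hn | hn
      · exact congrFun h ⟨n, hn⟩
      · obtain ⟨k, rfl⟩ : ∃ k, n = k + p := ⟨n - p, by omega⟩
        rw [hθ k (by omega), hη k (by omega), ih k (by omega)]
  have : {θ | EventuallyPeriodicSeq θ} =
      ⋃ p : ℕ, ⋃ N : ℕ, {θ : ℕ → Bool | 0 < p ∧ ∀ n, N ≤ n → θ (n + p) = θ n} := by
    ext θ; simp [EventuallyPeriodicSeq]
  rw [this]
  exact Set.countable_iUnion fun p => Set.countable_iUnion fun N => (hfin p N).countable

/-- The admissible sequence with `true` in even positions and `x` in odd positions. -/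
def interleaveTrue (x : ℕ → Bool) (n : ℕ) : Bool := if Even n then true else x (n / 2)

theorem interleaveTrue_odd (x : ℕ → Bool) (k : ℕ) : interleaveTrue x (2 * k + 1) = x k := by
  have h1 : ¬ Even (2 * k + 1) := by simp
  have h2 : (2 * k + 1) / 2 = k := by omega
  rw [interleaveTrue, if_neg h1, h2]

theorem interleaveTrue_succ (x : ℕ → Bool) (n : ℕ) (h : interleaveTrue x n = false) :
    interleaveTrue x (n + 1) = true := by
  by_cases hn : Even n
  · simp [interleaveTrue, hn] at h
  · simp [interleaveTrue, Nat.even_add_one, hn]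

theorem eventuallyPeriodicSeq_of_interleaveTrue {x : ℕ → Bool}
    (h : EventuallyPeriodicSeq (interleaveTrue x)) : EventuallyPeriodicSeq x := by
  obtain ⟨p, N, hp, h⟩ := h
  refine ⟨p, N, hp, fun n hn => ?_⟩
  -- A shift by p in x is a shift by 2p in the interleaved sequence, that is, its period used twice.
  rw [← interleaveTrue_odd x (n + p), ← interleaveTrue_odd x n,
    show 2 * (n + p) + 1 = (2 * n + 1 + p) + p by ring, h _ (by omega), h _ (by omega)]

/-! ### Aperiodic itineraries -/

namespace GoodParam
variable {s : ℝ} {θ : ℕ → Bool}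

/-- After hitting 0 the orbit runs around the critical 3-cycle. The point 0 belongs to both pieces,
but from the next visit on it is preceded by -s, with letter `false`, so admissibility forces the
letter `true`. -/
theorem eventuallyPeriodicSeq_of_postCrit_eq_zero (hs : GoodParam s)
    (hadm : ∀ n, θ n = false → θ (n + 1) = true)
    (hθ : ∀ i, postCrit s (i + 2) ∈ goldenPiece s (θ i)) {i : ℕ} (hi : postCrit s (i + 2) = 0) :
    EventuallyPeriodicSeq θ := by
  have h1 := hs.one_le
  have hZ : ∀ k, postCrit s (i + k + 2) ∈ ({0, 1, -s} : Set ℝ) := by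
    intro k
    rw [show i + k + 2 = k + (i + 2) by ring, postCrit_add, hi]
    exact hs.mapsTo_critCycle.iterate k (by simp)
  -- Starts at k + 1 because the letter at time i itself is ambiguous.
  have hlet : ∀ k, θ (i + (k + 1)) = decide (postCrit s (i + (k + 1) + 2) ≠ -s) := by
    intro k
    have e : postCrit s (i + (k + 1) + 2) = cubicMap s (postCrit s (i + k + 2)) := by
      rw [← postCrit_succ]; rfl
    have m1 := hθ (i + (k + 1))
    have m0 := hθ (i + k)
    have a0 := hadm (i + k)
    rw [e] at m1 ⊢
    rcases hZ k with h | h | h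
    · rw [h, map_zero] at m1 ⊢
      rw [decide_eq_true (by intro h; linarith)]
      cases hc : θ (i + (k + 1))
      · rw [hc] at m1; exact absurd m1.2 (by norm_num)
      · rfl
    · rw [h, hs.map_one] at m1 ⊢
      rw [decide_eq_false (by simp)]
      cases hc : θ (i + (k + 1))
      · rfl
      · rw [hc] at m1; exact absurd m1.1 (by simp; linarith)
    · rw [Set.mem_singleton_iff] at h
      rw [h] at m0
      rw [h, hs.map_neg, decide_eq_true (by intro h; linarith)]
      apply a0
      cases hc : θ (i + k)
      · rfl
      · rw [hc] at m0; exact absurd m0.1 (by simp; linarith)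
  refine ⟨3, i + 1, by norm_num, fun n hn => ?_⟩
  obtain ⟨k, rfl⟩ := Nat.exists_eq_add_of_le hn
  have e1 : i + 1 + k + 3 = i + (k + 3 + 1) := by ring
  have e2 : i + 1 + k = i + (k + 1) := by ring
  rw [e1, e2, hlet, hlet]
  have e3 : i + (k + 3 + 1) + 2 = 3 + (i + (k + 1) + 2) := by ring
  rw [e3, postCrit_add, (hs.iterate_critCycle_iff (hZ (k + 1)) 3).2 dvd_rfl]

theorem itinerary_eq (hs : GoodParam s) (hadm : ∀ n, θ n = false → θ (n + 1) = true)
    (hθ : ∀ i, postCrit s (i + 2) ∈ goldenPiece s (θ i)) (hper : ¬ EventuallyPeriodicSeq θ)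
    (i : ℕ) : θ i = decide (0 < postCrit s (i + 2)) := by
  have h0 : postCrit s (i + 2) ≠ 0 := fun h =>
    hper (hs.eventuallyPeriodicSeq_of_postCrit_eq_zero hadm hθ h)
  have := hθ i
  cases hc : θ i
  · rw [hc] at this
    exact (decide_eq_false (not_lt.2 this.2)).symm
  · rw [hc] at this
    exact (decide_eq_true (lt_of_le_of_ne this.1 h0.symm)).symm

theorem cubicCrit_mem_critSet (hs : GoodParam s) : cubicCrit s ∈ critSet (cubicF s) := by
  change (cubicF s).derivative.eval (cubicCrit s) = 0
  rw [eval_derivative, hs.cubicA_mul_crit]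
  ring

theorem not_isPCF (hs : GoodParam s) (hadm : ∀ n, θ n = false → θ (n + 1) = true)
    (hθ : ∀ i, postCrit s (i + 2) ∈ goldenPiece s (θ i)) (hper : ¬ EventuallyPeriodicSeq θ) :
    ¬ IsPCF (cubicF s) := by
  intro hP
  have hr : (Set.range (postCrit s)).Finite :=
    hP.subset (Set.subset_biUnion_of_mem (u := fun c => Set.range fun k : ℕ =>
      (fun x => (cubicF s).eval x)^[k] c) hs.cubicCrit_mem_critSet)
  have hinj : ¬ Function.Injective (postCrit s) := fun h => Set.infinite_range_of_injective h hr
  obtain ⟨k, l, hkl, hlt⟩ : ∃ k l, postCrit s k = postCrit s l ∧ k < l := by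
    simp only [Function.Injective, not_forall] at hinj
    obtain ⟨k, l, h, hne⟩ := hinj
    rcases lt_or_gt_of_ne hne with hlt | hlt
    · exact ⟨k, l, h, hlt⟩
    · exact ⟨l, k, h.symm, hlt⟩
  refine hper ⟨l - k, k, by omega, fun n hn => ?_⟩
  rw [hs.itinerary_eq hadm hθ hper, hs.itinerary_eq hadm hθ hper]
  have e1 : n + (l - k) + 2 = (n + 2 - k) + l := by omega
  have e2 : n + 2 = (n + 2 - k) + k := by omega
  rw [e1, postCrit_add, ← hkl, ← postCrit_add, ← e2]

/-- Convergence to a cycle of period n would make the signs eventually n-periodic. This is immediate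
where the limit point is nonzero, so only a cycle through 0 needs care. -/
theorem not_isAsymptoticTo (hs : GoodParam s) (hadm : ∀ n, θ n = false → θ (n + 1) = true)
    (hθ : ∀ i, postCrit s (i + 2) ∈ goldenPiece s (θ i)) (hper : ¬ EventuallyPeriodicSeq θ)
    {n : ℕ} (hn : 1 ≤ n) {x : ℝ} (hx : (cubicMap s)^[n] x = x) :
    ¬ IsAsymptoticTo (cubicMap s) (cubicCrit s) n x := by
  rintro ⟨m, hm⟩
  have h1 := hs.one_le
  have hne0 : ∀ i, postCrit s (i + 2) ≠ 0 := fun i h =>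
    hper (hs.eventuallyPeriodicSeq_of_postCrit_eq_zero hadm hθ h)
  have hlim : ∀ j, Tendsto (fun k : ℕ => postCrit s (k * n + m + j)) atTop
      (𝓝 ((cubicMap s)^[j] x)) := by
    intro j
    have := (((continuous_cubicMap s).iterate j).tendsto x).comp hm
    refine this.congr fun k => ?_
    rw [add_comm (k * n + m) j, postCrit_add]
    rfl
  have hsign : ∀ j, ∃ c : Bool, ∀ᶠ k in atTop, decide (0 < postCrit s (k * n + m + j)) = c := by
    intro j
    rcases lt_trichotomy ((cubicMap s)^[j] x) 0 with h | h | h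
    · refine ⟨false, ((hlim j).eventually (gt_mem_nhds h)).mono fun k hk => ?_⟩
      exact decide_eq_false (not_lt.2 hk.le)
    · refine ⟨true, ?_⟩
      -- A cycle through 0 is the critical cycle, so the limit one step earlier is -s. There the
      -- orbit is eventually negative, and the left branch sends it into [0, 1]; the value 0 is
      -- excluded, so the sign at 0 is eventually positive.
      have hz : (cubicMap s)^[j + (n - 1)] x = -s := by
        rw [add_comm, Function.iterate_add_apply, h]
        have hmem := hs.mapsTo_critCycle.iterate (n - 1) (show (0 : ℝ) ∈ _ by simp)
        have hz0 : cubicMap s ((cubicMap s)^[n - 1] 0) = 0 := by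
          rw [← Function.iterate_succ_apply' (cubicMap s), show (n - 1).succ = n by omega, ← h,
            ← Function.iterate_add_apply, add_comm, Function.iterate_add_apply, hx]
        rcases hmem with h' | h' | h'
        · rw [h', map_zero] at hz0; exact absurd hz0 (by norm_num)
        · rw [h', hs.map_one] at hz0; linarith
        · exact h'
      have hlt := (hlim (j + (n - 1))).eventually (gt_mem_nhds (show _ < (0 : ℝ) by rw [hz]; linarith))
      obtain ⟨K, hK⟩ := eventually_atTop.1 hlt
      filter_upwards [eventually_ge_atTop (K + 2)] with k hk
      obtain ⟨q, rfl⟩ := Nat.exists_eq_add_of_le hk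
      have h2 := hK (K + q + 1) (by omega)
      -- The index must be at least 2, as the letters, and with them the exclusion of 0, begin at
      -- the second image of the critical point.
      have hge : 2 ≤ (K + q + 1) * n + m + (j + (n - 1)) + 1 := by nlinarith
      have e : (K + 2 + q) * n + m + j = (K + q + 1) * n + m + (j + (n - 1)) + 1 := by
        have : (K + 2 + q) * n = (K + q + 1) * n + n := by ring
        omega
      obtain ⟨i, hi⟩ := Nat.exists_eq_add_of_le' hge
      have hne := hne0 i
      have hI := hs.postCrit_mem ((K + q + 1) * n + m + (j + (n - 1)) - 1)
      rw [Nat.sub_add_cancel (by nlinarith)] at hI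
      rw [← hi, postCrit_succ] at hne
      rw [e, postCrit_succ]
      exact decide_eq_true (lt_of_le_of_ne (hs.mapsTo_left ⟨hI.1, h2.le⟩).1 hne.symm)
    · exact ⟨true, ((hlim j).eventually (lt_mem_nhds h)).mono fun k hk => decide_eq_true hk⟩
  choose c hc using hsign
  have hall : ∀ᶠ k in atTop, ∀ j ∈ Finset.range n,
      decide (0 < postCrit s (k * n + m + j)) = c j :=
    (eventually_all_finset _).2 fun j _ => hc j
  obtain ⟨K, hK⟩ := eventually_atTop.1 hall
  refine hper ⟨n, K * n + m, hn, fun i hi => ?_⟩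
  rw [hs.itinerary_eq hadm hθ hper, hs.itinerary_eq hadm hθ hper]
  obtain ⟨d, hd⟩ := Nat.exists_eq_add_of_le hi
  obtain ⟨q, r, hq, hr⟩ : ∃ q r, q * n + r = d + 2 ∧ r < n :=
    ⟨_, _, Nat.div_add_mod' (d + 2) n, Nat.mod_lt _ hn⟩
  have e1 : i + 2 = (K + q) * n + m + r := by linarith
  have e2 : i + n + 2 = (K + q + 1) * n + m + r := by linarith
  rw [e1, e2, hK (K + q) (by omega) r (Finset.mem_range.2 hr),
    hK (K + q + 1) (by omega) r (Finset.mem_range.2 hr)]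

theorem not_isHyperbolicPoly (hs : GoodParam s) (hadm : ∀ n, θ n = false → θ (n + 1) = true)
    (hθ : ∀ i, postCrit s (i + 2) ∈ goldenPiece s (θ i)) (hper : ¬ EventuallyPeriodicSeq θ) :
    ¬ IsHyperbolicPoly (cubicF s) := by
  intro hH
  rcases hH _ hs.cubicCrit_mem_critSet with ⟨n, x, ⟨hn, hx, -⟩, hA⟩ | h
  · exact hs.not_isAsymptoticTo hadm hθ hper hn hx hA
  · have h1 := hs.one_le
    obtain ⟨k, hk, hk1⟩ := ((h.eventually (eventually_gt_atTop s)).and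
      (eventually_ge_atTop 1)).exists
    obtain ⟨j, rfl⟩ := Nat.exists_eq_add_of_le' hk1
    have := hs.postCrit_mem j
    exact absurd hk (not_lt.2 (abs_le.2 ⟨this.1, this.2.trans h1⟩))

/-! ### Degree and critical points -/

theorem natDegree_cubicF (hs : GoodParam s) : (cubicF s).natDegree = 3 := by
  have := hs.cubicA_neg.ne
  unfold cubicF
  compute_degree!

theorem complex_critical_points (hs : GoodParam s) :
    {z : ℂ | aeval z (cubicF s).derivative = 0} = {((0 : ℝ) : ℂ), (cubicCrit s : ℂ)} := by
  have ha : (cubicA s : ℂ) ≠ 0 := by exact_mod_cast hs.cubicA_neg.ne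
  have hc : (3 : ℂ) * cubicA s * cubicCrit s = -2 * cubicB s := by
    exact_mod_cast hs.cubicA_mul_crit
  ext z
  have e : aeval z (cubicF s).derivative = 3 * cubicA s * z * (z - cubicCrit s) := by
    have : aeval z (cubicF s).derivative = z * (3 * cubicA s * z + 2 * cubicB s) := by
      simp [cubicF]; ring
    rw [this]
    linear_combination z * hc
  simp only [Set.mem_ofPred_eq, Set.mem_insert_iff, Set.mem_singleton_iff, e, mul_eq_zero,
    sub_eq_zero, ha, Complex.ofReal_zero]
  norm_num

end GoodParam

/-! ### Uncountably many parameters, and the main theorem -/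

theorem not_countable_aperiodic {t : ℝ} (h1t : 1 < t) (ht : ∀ s ∈ Set.Icc 1 t, GoodParam s)
    (hend : t ^ 3 * (t + 1) = 2 + 3 * t) :
    ¬ {s : ℝ | s ∈ Set.Icc 1 t ∧ ¬ IsPCF (cubicF s) ∧ ¬ IsHyperbolicPoly (cubicF s)}.Countable := by
  intro hcount
  have hex : ∀ x : ℕ → Bool, ∃ s ∈ Set.Icc 1 t,
      ∀ i, postCrit s (i + 2) ∈ goldenPiece s (interleaveTrue x i) := fun x =>
    exists_param h1t ht hend (by simp [interleaveTrue]) (interleaveTrue_succ x)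
  choose σ hσ hσθ using hex
  have hap : {x | EventuallyPeriodicSeq x}ᶜ.Countable := by
    -- For sequences that are not eventually periodic the parameter determines the itinerary by
    -- signs, so choosing a parameter is injective on them.
    refine Set.MapsTo.countable_of_injOn (f := σ) (fun x hx => ?_) (fun x hx y hy hxy => ?_) hcount
    · have hx' : ¬ EventuallyPeriodicSeq (interleaveTrue x) := fun h =>
        hx (eventuallyPeriodicSeq_of_interleaveTrue h)
      have hs := ht _ (hσ x)
      exact ⟨hσ x, hs.not_isPCF (interleaveTrue_succ x) (hσθ x) hx',
        hs.not_isHyperbolicPoly (interleaveTrue_succ x) (hσθ x) hx'⟩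
    · have hx' : ¬ EventuallyPeriodicSeq (interleaveTrue x) := fun h =>
        hx (eventuallyPeriodicSeq_of_interleaveTrue h)
      have hy' : ¬ EventuallyPeriodicSeq (interleaveTrue y) := fun h =>
        hy (eventuallyPeriodicSeq_of_interleaveTrue h)
      funext k
      rw [← interleaveTrue_odd x, ← interleaveTrue_odd y,
        (ht _ (hσ x)).itinerary_eq (interleaveTrue_succ x) (hσθ x) hx',
        (ht _ (hσ y)).itinerary_eq (interleaveTrue_succ y) (hσθ y) hy', hxy]
  have huniv : (Set.univ : Set (ℕ → Bool)).Countable := by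
    rw [← Set.union_compl_self {x | EventuallyPeriodicSeq x}]
    exact countable_eventuallyPeriodicSeq.union hap
  rw [Set.countable_univ_iff] at huniv
  -- Cantor's diagonal argument.
  obtain ⟨g, hg⟩ := exists_surjective_nat (ℕ → Bool)
  obtain ⟨k, hk⟩ := hg fun n => !(g n n)
  simpa using congrFun hk k

theorem mainTheorem5 :
    ∃ sStar : ℝ, 1 < sStar ∧
      (∀ s ∈ Set.Icc 1 sStar,
        -- `F_s` is cubic, and its complex critical points are two distinct real numbers
        (cubicF s).natDegree = 3 ∧
        (∃ c₁ c₂ : ℝ, c₁ ≠ c₂ ∧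
          {z : ℂ | aeval z (cubicF s).derivative = 0} = {(c₁ : ℂ), (c₂ : ℂ)}) ∧
        -- the zeta function of the map `F_s : ℝ → ℝ` is defined, and has the stated value
        (∀ n : ℕ, 1 ≤ n → {x : ℝ | (fun y => (cubicF s).eval y)^[n] x = x}.Finite) ∧
        artinMazurZeta (fun x : ℝ => (cubicF s).eval x) =
          ((1 - PowerSeries.X ^ 3) * (1 - PowerSeries.X ^ 2) *
            (1 - PowerSeries.X - PowerSeries.X ^ 2))⁻¹) ∧
      ¬ {s : ℝ | s ∈ Set.Icc 1 sStar ∧ ¬ IsPCF (cubicF s) ∧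
          ¬ IsHyperbolicPoly (cubicF s)}.Countable := by
  obtain ⟨t, h1t, hend, ht⟩ := exists_goodParam_endpoint
  refine ⟨t, h1t, fun s hs => ?_, not_countable_aperiodic h1t ht hend⟩
  have hg := ht s hs
  refine ⟨hg.natDegree_cubicF, ⟨0, cubicCrit s, ?_, hg.complex_critical_points⟩,
    fun n hn => hg.finite_fixed (Nat.one_le_iff_ne_zero.1 hn),
    artinMazurZeta_eq_of_card _ hg.numIsolatedFixedPts_cubicMap⟩
  have := hg.crit_le
  have := hg.one_le
  intro h
  linarith
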